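/- **Algebra and groups.** Let $\sigma=\pm1$ (signature) and $\Lambda\in\mathbb R$ (cosmological constant), not both $\sigma=+1$ and $\Lambda>0$; put $s=\operatorname{sign}\Lambda$. Let $\eta=\mathrm{diag}(1,-s\sigma,-s)$ if $\Lambda\neq0$ and $\eta=\mathrm{diag}(1,1,\sigma)$ if $\Lambda=0$, and let $n=(0,0,-s\sigma\sqrt{|\Lambda|})$, so that $n^2=-\Lambda$. Let $\mathfrak d$ be the real Lie algebra with basis $J_I,P_I$ ($I=1,2,3$) and $[J_I,J_J]=\epsilon_{IJ}{}^KJ_K$, $[J_I,P_J]=\epsilon_{IJ}{}^KP_K$, $[P_I,P_J]=\sigma\Lambda\,\epsilon_{IJ}{}^KJ_K$ (indices moved with $\eta$, $\epsilon_{123}=1$). Let $\tau_I=P_I+n^J\epsilon_{IJK}J^K$. Then $\mathfrak{su}=\langle J_I\rangle$ and $\mathfrak{an}=\langle\tau_I\rangle$ are subalgebras, isotropic for the invariant symmetric pairing determined by $\langle J^I,\tau_J\rangle=\delta^I_J$. Concretely, $\mathfrak d$ is the space of imaginary elements of the quaternion algebra over $\mathbb R[\theta]/(\theta^2-\sigma\Lambda)$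 with $i^2=-\sigma$, $j^2=-\eta_{33}$ and $k=ij$, where $J_1=i/2$, $J_2=j/2$, $J_3=\eta_{33}k/2$, $P_I=\theta J_I$. Let $\mathfrak D$ be the group of elements of norm one of this algebra ($SL(2,\mathbb C)$ if $\sigma=1,\Lambda<0$), $SU\subset\mathfrak D$ the subgroup of norm-one elements of the real span of $1,J_1,J_2,J_3$, and $AN\subset\mathfrak D$ the connected subgroup with Lie algebra $\mathfrak{an}$. **Fields.** Let $\Sigma$ be a smooth surface and let $c^*,c'^*\subset\Sigma$ be two cells which share the smooth edge $[vv']$. After truncation to flat connections a field configuration in a cell is $\mathcal A=\omega+e=G^{-1}\mathrm dG$ with a smooth $\mathfrak D$-valued holonomy $G(x)=\ell(x)h(x)$, $\ell(x)\in AN$, $h(x)\in SU$. Consider configurations $G_c=\ell_ch_c$ on $c^*$ and $G_{c'}=\ell_{c'}h_{c'}$ on $c'^*$, depending smoothly on parameters in an open subset of a real normed space, which satisfy the continuity equation $G_c^{-1}\mathrm dG_c=G_{c'}^{-1}\mathrm dG_{c'}$ along $[vv']$. Let $\delta$ be the exterior derivative with respect to the parameters, $\Delta u=\delta u\,u^{-1}$,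 $\underline\Delta u=u^{-1}\delta u$, and $\langle\alpha\wedge\beta\rangle(X,Y)=\langle\alpha(X),\beta(Y)\rangle-\langle\alpha(Y),\beta(X)\rangle$. The contribution of an oriented edge $\epsilon$ to the symplectic form of the cell $c^*$ is $$\Omega_c^{\epsilon}=\delta\Theta_c^{\epsilon},\qquad \Theta_c^{\epsilon}=-\int_{\epsilon}\langle\ell_c^{-1}\mathrm d\ell_c,\Delta h_c\rangle ,$$ and the symplectic form of the link $[cc']$ is $\Omega_{cc'}=\Omega_c^{[vv']}+\Omega_{c'}^{[v'v]}$. Define the triangular holonomies $$L^{c}_{vv'}=\ell_c(v)^{-1}\ell_c(v'),\quad L^{c'}_{vv'}=\ell_{c'}(v)^{-1}\ell_{c'}(v')\in AN,\qquad H^x_{cc'}=h_c(x)\,h_{c'}(x)^{-1}\in SU\quad(x=v,v').$$ **Theorem.** The triangular holonomies satisfy the ribbon relation $L^c_{vv'}H^{v'}_{cc'}=H^v_{cc'}L^{c'}_{vv'}$, and $$\Omega_{cc'}=\Omega_c^{[vv']}-\Omega_{c'}^{[vv']}=\tfrac12\Big(\big\langle\Delta H^v_{cc'}\wedge\Delta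 L^c_{vv'}\big\rangle+\big\langle\underline\Delta H^{v'}_{cc'}\wedge\underline\Delta L^{c'}_{vv'}\big\rangle\Big),$$ which is the pull-back of the Heisenberg-double two-form $\tfrac12\big(\langle\Delta\tilde h\wedge\Delta\ell\rangle+\langle\underline\Delta h\wedge\underline\Delta\tilde\ell\rangle\big)$, defined where $\mathfrak D\ni\ell h=\tilde h\tilde\ell$ with $\ell,\tilde\ell\in AN$ and $h,\tilde h\in SU$, under the map with $\ell=L^c_{vv'}$, $h=H^{v'}_{cc'}$, $\tilde h=H^v_{cc'}$, $\tilde\ell=L^{c'}_{vv'}$. -/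

import Mathlib

open scoped Manifold ContDiff
open Set

noncomputable section

namespace LoopGravity

/-! ### Metric, preferred vector and the algebra containing `𝔇` -/

/-- The signature `σ = ±1` as a real number. -/
abbrev sgn (σ : ℤˣ) : ℝ := ((σ : ℤ) : ℝ)

/-- The diagonal entries of the internal metric: `diag(+, +, σ)` if `Λ = 0`, and
`diag(+, -sσ, -s)` with `s = sign Λ` if `Λ ≠ 0`. -/
def eta (σ : ℤˣ) (Λ : ℝ) : Fin 3 → ℝ :=
  if Λ = 0 then ![1, 1, sgn σ] else ![1, -(Real.sign Λ * sgn σ), -Real.sign Λ]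

/-- The only nonzero component `n³ = -sσ√|Λ|` of the vector `n = (0, 0, n³)`; `n² = -Λ`. -/
def n3 (σ : ℤˣ) (Λ : ℝ) : ℝ := -(Real.sign Λ * sgn σ * √|Λ|)

/-- The real algebra `ℝ[θ]`, `θ² = σΛ`. -/
abbrev Scal (σ : ℤˣ) (Λ : ℝ) : Type := QuadraticAlgebra ℝ (sgn σ * Λ) 0

/-- The quaternion algebra over `ℝ[θ]` with `i² = -σ`, `j² = -η₃₃`, `k = ij = -ji`
(of real dimension eight).  The Lie algebra `𝔡` is its imaginary part with the commutator,
`𝔇` its group of elements of norm one; for `σ = 1` and `Λ < 0` the latter is `SL(2, ℂ)`. -/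
abbrev DAlg (σ : ℤˣ) (Λ : ℝ) : Type :=
  QuaternionAlgebra (Scal σ Λ) (algebraMap ℝ (Scal σ Λ) (-sgn σ)) 0
    (algebraMap ℝ (Scal σ Λ) (-(eta σ Λ 2)))

variable {σ : ℤˣ} {Λ : ℝ}

/-- Real coordinates on the algebra. -/
def coords (σ : ℤˣ) (Λ : ℝ) : DAlg σ Λ →ₗ[ℝ] (Fin 8 → ℝ) where
  toFun x := ![x.re.re, x.re.im, x.imI.re, x.imI.im, x.imJ.re, x.imJ.im, x.imK.re, x.imK.im]
  map_add' x y := by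
    ext i; fin_cases i <;> simp
  map_smul' c x := by
    ext i; fin_cases i <;> simp

lemma coords_injective (σ : ℤˣ) (Λ : ℝ) : Function.Injective (coords σ Λ) := by
  intro x y h
  have h' := fun i => congrFun h i
  ext
  · exact h' 0
  · exact h' 1
  · exact h' 2
  · exact h' 3
  · exact h' 4
  · exact h' 5
  · exact h' 6
  · exact h' 7

/-- A norm on the finite-dimensional real vector space underlying the algebra (the sup norm of the
coordinates); it only serves to speak of derivatives, and any norm would do. -/
instance : NormedAddCommGroup (DAlg σ Λ) :=
  NormedAddCommGroup.induced (DAlg σ Λ) (Fin 8 → ℝ) (coords σ Λ) (coords_injective σ Λ)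

instance : NormedSpace ℝ (DAlg σ Λ) :=
  NormedSpace.induced ℝ (DAlg σ Λ) (Fin 8 → ℝ) (coords σ Λ)

instance : FiniteDimensional ℝ (DAlg σ Λ) :=
  Module.Finite.of_injective (coords σ Λ) (coords_injective σ Λ)

/-! ### Generators, pairing, and the groups `SU` and `AN` -/

/-- The rotation generators with lower index; `[J_I, J_J] = ε_{IJ}^K J_K`. -/
def J (σ : ℤˣ) (Λ : ℝ) : Fin 3 → DAlg σ Λ :=
  ![⟨0, algebraMap ℝ _ (1 / 2), 0, 0⟩, ⟨0, 0, algebraMap ℝ _ (1 / 2), 0⟩,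
    ⟨0, 0, 0, algebraMap ℝ _ (eta σ Λ 2 / 2)⟩]

/-- The rotation generators with raised index. -/
def Jup (σ : ℤˣ) (Λ : ℝ) (I : Fin 3) : DAlg σ Λ := eta σ Λ I • J σ Λ I

/-- The boost generators `P_I = θ J_I`; `[J_I, P_J] = ε_{IJ}^K P_K`,
`[P_I, P_J] = σΛ ε_{IJ}^K J_K`. -/
def P (σ : ℤˣ) (Λ : ℝ) (I : Fin 3) : DAlg σ Λ := (⟨0, 1⟩ : Scal σ Λ) • J σ Λ I

/-- The generators `τ_I = P_I + n^J ε_{IJK} J^K` of `𝔞𝔫`, for `n = (0, 0, n³)`. -/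
def tau (σ : ℤˣ) (Λ : ℝ) : Fin 3 → DAlg σ Λ :=
  ![P σ Λ 0 - n3 σ Λ • Jup σ Λ 1, P σ Λ 1 + n3 σ Λ • Jup σ Λ 0, P σ Λ 2]

/-- The invariant symmetric pairing: `⟨J^I, τ_J⟩ = δ^I_J`, while the span of the `J_I` and the span
of the `τ_I` are isotropic.  In the quaternion model it is `-4σ` times the `θ`-component of the
scalar part of the product. -/
def pairing (σ : ℤˣ) (Λ : ℝ) : DAlg σ Λ →ₗ[ℝ] DAlg σ Λ →ₗ[ℝ] ℝ :=
  (LinearMap.mul ℝ (DAlg σ Λ)).compr₂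
    ((-4 * sgn σ) • (LinearMap.proj 1 ∘ₗ coords σ Λ))

lemma sgn_cases (σ : ℤˣ) : sgn σ = 1 ∨ sgn σ = -1 := by
  rcases Int.units_eq_one_or σ with h | h <;> simp [sgn, h]

lemma eta_cases (σ : ℤˣ) (Λ : ℝ) :
    eta σ Λ 0 = 1 ∧ eta σ Λ 1 = sgn σ * eta σ Λ 2 ∧ (eta σ Λ 2 = 1 ∨ eta σ Λ 2 = -1) ∧
      n3 σ Λ ^ 2 = -(eta σ Λ 2 * Λ) := by
  rcases lt_trichotomy Λ 0 with h | h | h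
  · rcases sgn_cases σ with s | s <;>
      simp [eta, n3, h.ne, s, Real.sign_of_neg h, abs_of_neg h, Real.sq_sqrt, h.le]
  · rcases sgn_cases σ with s | s <;> simp [eta, n3, h, s]
  · rcases sgn_cases σ with s | s <;>
      simp [eta, n3, h.ne', s, Real.sign_of_pos h, abs_of_pos h, Real.sq_sqrt, h.le]

lemma re_one' : (1 : Scal σ Λ).re = 1 := rfl

lemma im_one' : (1 : Scal σ Λ).im = 0 := rfl

lemma su_mk (r : ℝ) (x : Fin 3 → ℝ) :
    r • (1 : DAlg σ Λ) + ∑ I, x I • J σ Λ I =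
      ⟨⟨r, 0⟩, ⟨x 0 / 2, 0⟩, ⟨x 1 / 2, 0⟩, ⟨eta σ Λ 2 * x 2 / 2, 0⟩⟩ := by
  ext <;> simp [re_one', im_one', Fin.sum_univ_three, J] <;> ring

lemma an_mk (r : ℝ) (x : Fin 3 → ℝ) :
    r • (1 : DAlg σ Λ) + ∑ I, x I • tau σ Λ I =
      ⟨⟨r, 0⟩, ⟨n3 σ Λ * x 1 / 2, x 0 / 2⟩, ⟨-(n3 σ Λ * eta σ Λ 1 * x 0 / 2), x 1 / 2⟩,
        ⟨0, eta σ Λ 2 * x 2 / 2⟩⟩ := by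
  ext <;> simp [re_one', im_one', Fin.sum_univ_three, tau, P, Jup, J, (eta_cases σ Λ).1] <;> ring

lemma su_mul (r s : ℝ) (x y : Fin 3 → ℝ) :
    (r • (1 : DAlg σ Λ) + ∑ I, x I • J σ Λ I) * (s • 1 + ∑ I, y I • J σ Λ I) =
      (r * s - sgn σ / 4 * (x 0 * y 0 + eta σ Λ 1 * (x 1 * y 1) + eta σ Λ 2 * (x 2 * y 2))) • 1 +
        ∑ I, ![r * y 0 + s * x 0 + (x 1 * y 2 - x 2 * y 1) / 2,
          r * y 1 + s * x 1 + eta σ Λ 1 * (x 2 * y 0 - x 0 * y 2) / 2,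
          r * y 2 + s * x 2 + eta σ Λ 2 * (x 0 * y 1 - x 1 * y 0) / 2] I • J σ Λ I := by
  obtain ⟨-, h1, h2, -⟩ := eta_cases σ Λ
  rw [su_mk, su_mk, su_mk, h1, QuaternionAlgebra.mk_mul_mk]
  ext <;> simp <;> rcases sgn_cases σ with hs | hs <;> rcases h2 with h2 | h2 <;>
  grind

lemma an_mul (r s : ℝ) (x y : Fin 3 → ℝ) :
    (r • (1 : DAlg σ Λ) + ∑ I, x I • tau σ Λ I) * (s • 1 + ∑ I, y I • tau σ Λ I) =
      (r * s + n3 σ Λ ^ 2 / 4 * (x 2 * y 2)) • 1 +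
        ∑ I, ![r * y 0 + s * x 0 + eta σ Λ 1 * n3 σ Λ / 2 * (x 2 * y 0 - x 0 * y 2),
          r * y 1 + s * x 1 + eta σ Λ 1 * n3 σ Λ / 2 * (x 2 * y 1 - x 1 * y 2),
          r * y 2 + s * x 2] I • tau σ Λ I := by
  obtain ⟨-, h1, h2, hn⟩ := eta_cases σ Λ
  rw [an_mk, an_mk, an_mk, h1, QuaternionAlgebra.mk_mul_mk]
  generalize n3 σ Λ = n at hn ⊢
  ext <;> simp <;> rcases sgn_cases σ with hs | hs <;> rcases h2 with h2 | h2 <;> grind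

lemma star_su (r : ℝ) (x : Fin 3 → ℝ) :
    star (r • (1 : DAlg σ Λ) + ∑ I, x I • J σ Λ I) = r • 1 + ∑ I, (-x) I • J σ Λ I := by
  rw [su_mk, su_mk]
  ext <;> simp <;> ring

lemma star_an (r : ℝ) (x : Fin 3 → ℝ) :
    star (r • (1 : DAlg σ Λ) + ∑ I, x I • tau σ Λ I) = r • 1 + ∑ I, (-x) I • tau σ Λ I := by
  rw [an_mk, an_mk]
  ext <;> simp <;> ring

lemma an_norm (r : ℝ) (x : Fin 3 → ℝ)
    (h : (r • (1 : DAlg σ Λ) + ∑ I, x I • tau σ Λ I) *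
      star (r • (1 : DAlg σ Λ) + ∑ I, x I • tau σ Λ I) = 1) :
    r ^ 2 - (n3 σ Λ * x 2 / 2) ^ 2 = 1 := by
  rw [star_an, an_mul, an_mk] at h
  have := congrArg (fun z => z.re.re) h
  simp [re_one'] at this
  linear_combination this

/-- The group `SU`: elements of norm one in the real quaternion algebra spanned by `1, J_I`
(a copy of `SU(2)` if `η` is definite, and of `SU(1,1) ≅ SL(2, ℝ)` otherwise). -/
def SU (σ : ℤˣ) (Λ : ℝ) : Subgroup (DAlg σ Λ)ˣ where
  carrier := {u | (u : DAlg σ Λ) * star (u : DAlg σ Λ) = 1 ∧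
    ∃ (r : ℝ) (x : Fin 3 → ℝ), (u : DAlg σ Λ) = r • 1 + ∑ I, x I • J σ Λ I}
  one_mem' := by
    refine ⟨by simp, 1, 0, by simp⟩
  mul_mem' := by
    rintro u v ⟨hu, r, x, hx⟩ ⟨hv, s, y, hy⟩
    refine ⟨?_, ?_⟩
    · rw [Units.val_mul, star_mul, mul_assoc, ← mul_assoc (v : DAlg σ Λ), hv, one_mul, hu]
    · exact ⟨_, _, by rw [Units.val_mul, hx, hy, su_mul]⟩
  inv_mem' := by
    rintro u ⟨hu, r, x, hx⟩
    have hi : ((u⁻¹ : (DAlg σ Λ)ˣ) : DAlg σ Λ) = star (u : DAlg σ Λ) := by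
      rw [Units.inv_eq_of_mul_eq_one_right hu]
    refine ⟨?_, r, -x, ?_⟩
    · rw [hi, star_star, ← hi, Units.inv_mul]
    · rw [hi, hx, star_su]

/-- The group `AN`: elements `r + x^I τ_I` of norm one with `r > 0`, i.e. the connected group
`exp(ℝ τ₃) exp(ℝ τ₁ + ℝ τ₂)` with Lie algebra `𝔞𝔫`. -/
def AN (σ : ℤˣ) (Λ : ℝ) : Subgroup (DAlg σ Λ)ˣ where
  carrier := {u | (u : DAlg σ Λ) * star (u : DAlg σ Λ) = 1 ∧
    ∃ (r : ℝ) (x : Fin 3 → ℝ), 0 < r ∧ (u : DAlg σ Λ) = r • 1 + ∑ I, x I • tau σ Λ I}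
  one_mem' := by
    refine ⟨by simp, 1, 0, by simp⟩
  mul_mem' := by
    rintro u v ⟨hu, r, x, hr, hx⟩ ⟨hv, s, y, hs, hy⟩
    refine ⟨?_, ?_⟩
    · rw [Units.val_mul, star_mul, mul_assoc, ← mul_assoc (v : DAlg σ Λ), hv, one_mul, hu]
    · refine ⟨_, _, ?_, by rw [Units.val_mul, hx, hy, an_mul]⟩
      have h1 := an_norm r x (hx ▸ hu)
      have h2 := an_norm s y (hy ▸ hv)
      have h3 : |n3 σ Λ * x 2 / 2| < r := abs_lt_of_sq_lt_sq (by linarith) hr.le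
      have h4 : |n3 σ Λ * y 2 / 2| < s := abs_lt_of_sq_lt_sq (by linarith) hs.le
      have h5 := mul_lt_mul'' h3 h4 (abs_nonneg _) (abs_nonneg _)
      rw [← abs_mul] at h5
      have h6 := neg_abs_le (n3 σ Λ * x 2 / 2 * (n3 σ Λ * y 2 / 2))
      nlinarith
  inv_mem' := by
    rintro u ⟨hu, r, x, hr, hx⟩
    have hi : ((u⁻¹ : (DAlg σ Λ)ˣ) : DAlg σ Λ) = star (u : DAlg σ Λ) := by
      rw [Units.inv_eq_of_mul_eq_one_right hu]
    refine ⟨?_, r, -x, hr, ?_⟩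
    · rw [hi, star_star, ← hi, Units.inv_mul]
    · rw [hi, hx, star_an]

/-! ### Variations: differential forms on a space of parameters of the fields -/

section Variations

variable {F : Type*} [NormedAddCommGroup F] [NormedSpace ℝ F]

/-- `Δ u = δu u⁻¹` at the parameter `p`. -/
def varR (u : F → (DAlg σ Λ)ˣ) (p : F) : F →L[ℝ] DAlg σ Λ :=
  (LinearMap.toContinuousLinearMap
    (LinearMap.mulRight ℝ (((u p)⁻¹ : (DAlg σ Λ)ˣ) : DAlg σ Λ))).comp
      (fderiv ℝ (fun q => (u q : DAlg σ Λ)) p)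

/-- `Δ̲ u = u⁻¹ δu` at the parameter `p`. -/
def varL (u : F → (DAlg σ Λ)ˣ) (p : F) : F →L[ℝ] DAlg σ Λ :=
  (LinearMap.toContinuousLinearMap
    (LinearMap.mulLeft ℝ (((u p)⁻¹ : (DAlg σ Λ)ˣ) : DAlg σ Λ))).comp
      (fderiv ℝ (fun q => (u q : DAlg σ Λ)) p)

/-- The two-form `⟨α ∧ β⟩` built from two algebra-valued one-forms, evaluated on `X, Y`. -/
def pairWedge (α β : F →L[ℝ] DAlg σ Λ) (X Y : F) : ℝ :=
  pairing σ Λ (α X) (β Y) - pairing σ Λ (α Y) (β X)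

end Variations

/-! ### Truncated fields in a cell, and the contribution of an edge to the symplectic form -/

section Cells

variable {F : Type*} [NormedAddCommGroup F] [NormedSpace ℝ F]
  {S : Type*} [TopologicalSpace S] [ChartedSpace (EuclideanSpace ℝ (Fin 2)) S]

/-- A family, with parameters in `U`, of truncated field configurations in the cell `C` of the
surface `S`: smooth holonomies `G(x) = ℓ(x) h(x)`, `ℓ(x) ∈ AN`, `h(x) ∈ SU`.  The connection
`𝒜 = ω + e` in the cell is the flat connection `G⁻¹ dG`. -/
structure CellField (σ : ℤˣ) (Λ : ℝ) (U : Set F) (C : Set S) where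
  /-- the `AN` factor `ℓ` -/
  ell : F → S → (DAlg σ Λ)ˣ
  /-- the `SU` factor `h` -/
  hol : F → S → (DAlg σ Λ)ˣ
  ell_mem : ∀ p ∈ U, ∀ x ∈ C, ell p x ∈ AN σ Λ
  hol_mem : ∀ p ∈ U, ∀ x ∈ C, hol p x ∈ SU σ Λ
  /-- an open neighbourhood of the cell to which the fields extend smoothly -/
  nhd : Set S
  isOpen_nhd : IsOpen nhd
  subset_nhd : C ⊆ nhd
  smooth_ell : ContMDiffOn (𝓘(ℝ, F).prod (𝓡 2)) 𝓘(ℝ, DAlg σ Λ) ∞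
    (fun q : F × S => (ell q.1 q.2 : DAlg σ Λ)) (U ×ˢ nhd)
  smooth_hol : ContMDiffOn (𝓘(ℝ, F).prod (𝓡 2)) 𝓘(ℝ, DAlg σ Λ) ∞
    (fun q : F × S => (hol q.1 q.2 : DAlg σ Λ)) (U ×ˢ nhd)

namespace CellField

variable {U : Set F} {C : Set S}

/-- The `𝔇`-valued holonomy `G(x) = ℓ(x) h(x)`. -/
def G (c : CellField σ Λ U C) (p : F) (x : S) : (DAlg σ Λ)ˣ := c.ell p x * c.hol p x

/-- The pull-back of `ℓ⁻¹ dℓ` to the edge `γ : [0,1] → S`, as a function of the parameter `t`. -/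
def ellForm (c : CellField σ Λ U C) (γ : ℝ → S) (p : F) (t : ℝ) : DAlg σ Λ :=
  (((c.ell p (γ t))⁻¹ : (DAlg σ Λ)ˣ) : DAlg σ Λ) *
    derivWithin (fun s => (c.ell p (γ s) : DAlg σ Λ)) (Icc 0 1) t

/-- The pull-back of the connection `𝒜 = G⁻¹ dG` to the edge `γ : [0,1] → S`. -/
def connForm (c : CellField σ Λ U C) (γ : ℝ → S) (p : F) (t : ℝ) : DAlg σ Λ :=
  (((c.G p (γ t))⁻¹ : (DAlg σ Λ)ˣ) : DAlg σ Λ) *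
    derivWithin (fun s => (c.G p (γ s) : DAlg σ Λ)) (Icc 0 1) t

/-- The integrand (a one-form on parameters) `⟨ℓ⁻¹ dℓ, Δh⟩` along the edge `γ`. -/
def integrand (c : CellField σ Λ U C) (γ : ℝ → S) (p : F) (t : ℝ) : F →L[ℝ] ℝ :=
  (LinearMap.toContinuousLinearMap (pairing σ Λ (c.ellForm γ p t))).comp
    (varR (fun q => c.hol q (γ t)) p)

/-- The symplectic potential of the edge, `Θ = -∫_γ ⟨ℓ⁻¹ dℓ, Δh⟩`, a one-form on parameters. -/
def edgePotential (c : CellField σ Λ U C) (γ : ℝ → S) (p : F) : F [⋀^Fin 1]→L[ℝ] ℝ :=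
  ContinuousAlternatingMap.ofSubsingleton ℝ F ℝ 0 (-∫ t in (0 : ℝ)..1, c.integrand γ p t)

/-- The contribution `δΘ` of the edge to the symplectic form of the cell. -/
def edgeForm (c : CellField σ Λ U C) (γ : ℝ → S) (p : F) : F [⋀^Fin 2]→L[ℝ] ℝ :=
  extDeriv (c.edgePotential γ) p

/-- The triangular holonomy `L_{vv'} = ℓ(v)⁻¹ ℓ(v') ∈ AN`. -/
def L (c : CellField σ Λ U C) (v v' : S) (p : F) : (DAlg σ Λ)ˣ := (c.ell p v)⁻¹ * c.ell p v'

/-- The triangular holonomy `H^v = h_c(v) h_{c'}(v)⁻¹ ∈ SU`. -/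
def H {C' : Set S} (c : CellField σ Λ U C) (c' : CellField σ Λ U C') (v : S) (p : F) :
    (DAlg σ Λ)ˣ := c.hol p v * (c'.hol p v)⁻¹

end CellField

/-- The reversed edge. -/
def revEdge (γ : ℝ → S) : ℝ → S := fun t => γ (1 - t)

/-- The symplectic form of the link dual to the edge `γ`: the contribution of the first cell plus
that of the second cell, in which the edge has the opposite orientation. -/
def linkForm {U : Set F} {C C' : Set S} (c : CellField σ Λ U C) (c' : CellField σ Λ U C')
    (γ : ℝ → S) (p : F) : F [⋀^Fin 2]→L[ℝ] ℝ :=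
  c.edgeForm γ p + c'.edgeForm (revEdge γ) p

end Cells

end LoopGravity

end

/-!
The symplectic potential of an edge is `-∫ ⟨ℓ⁻¹ dℓ, Δh⟩`, so its exterior derivative is minus the
integral over the edge of the curl of the density `⟨ℓ⁻¹ ∂_t ℓ, Δh⟩`.  The pairing is
`⟨x, y⟩ = T (x y)` for a trace `T` that vanishes on the real spans of `1, J_I` and of `1, τ_I`, which
are subalgebras; invariance and isotropy need nothing more.  Write `G = ℓ h`, `A = G⁻¹ ∂_t G` and
`Γ = G⁻¹ δG`.  The Maurer–Cartan equations and isotropy give (`two_mul_curl`)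

  `2 curl = ⟨δA ∧ Γ⟩ + ∂_t ⟨ℓ⁻¹ δℓ ∧ δh h⁻¹⟩`.

If `G` and `G'` have the same connection `A`, then
`⟨δA ∧ Γ⟩ - ⟨δA ∧ Γ'⟩ = ∂_t ⟨Γ' ∧ Γ⟩` by invariance of the pairing (`traceWedge_sub_traceWedge`).
Hence the difference of the two curls is a total derivative (`two_mul_curl_sub_curl`), and the link
form is half the difference of `boundaryForm` at the two endpoints (`edgeForm_sub_edgeForm`).

The same continuity equation makes the gluing element `G_c G_{c'}⁻¹ = ℓ_c H ℓ_{c'}⁻¹` constant along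
the edge.  Equality of its values at the endpoints is the ribbon relation, and the variation of that
equality, inserted into the two endpoint terms, turns their difference into the two-form of the
Heisenberg double (`traceWedge_ribbon`, `CellField.boundaryForm_sub`).

Elements of `AN` and `SU` have norm one, so `star` is used as a smooth, linear substitute for
inversion.  The fields along the edge are functions on `U × [0, 1]`, with derivatives taken within this
set; exchanging `δ` with the integral is `hasFDerivAt_integral_slice`.
-/

noncomputable section

namespace LoopGravity

/-! ### Trace identities in an associative algebra -/

section TraceIdentities

variable {A : Type*} [Ring A] [Algebra ℝ A] {T : A →ₗ[ℝ] ℝ}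

lemma trace_conj_mul (hT : ∀ x y, T (x * y) = T (y * x)) {h k : A} (hk : h * k = 1) (x y : A) :
    T (k * x * h * (k * y * h)) = T (x * y) := by
  have : k * x * h * (k * y * h) = k * (x * (h * k) * y * h) := by noncomm_ring
  rw [this, hk, hT, mul_one, mul_assoc, mul_assoc, hk, mul_one]

/-- Pointwise form of the key splitting.  Here `a` stands for `ℓ⁻¹ ∂_t ℓ`, `x, y` for the values of
`ℓ⁻¹ δℓ` and `u, v` for those of `δh h⁻¹` on two variations, primes are `t`-derivatives, and `k = h⁻¹`.
Twice the curl of `⟨ℓ⁻¹ ∂_t ℓ, Δh⟩` is a part built from the connection and `G⁻¹ δG` alone, plus the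
`t`-derivative of `⟨ℓ⁻¹ δℓ ∧ δh h⁻¹⟩`.  Isotropy of the two subalgebras removes the other terms. -/
lemma two_mul_density (hT : ∀ x y, T (x * y) = T (y * x)) {N K : Subalgebra ℝ A}
    (hN : ∀ x ∈ N, T x = 0) (hK : ∀ x ∈ K, T x = 0) {a x y x' y' u v u' v' h k : A}
    (hk : h * k = 1) (ha : a ∈ N) (hx : x ∈ N) (hy : y ∈ N) (hx' : x' ∈ N) (hy' : y' ∈ N)
    (hu : u ∈ K) (hv : v ∈ K) (hu' : u' ∈ K) (hv' : v' ∈ K) :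
    2 * (T ((x' + (a * x - x * a)) * v) - T ((y' + (a * y - y * a)) * u) +
        T (a * (u * v - v * u))) =
      T (k * (x' + u' + (a * (x + u) - (x + u) * a)) * h * (k * (y + v) * h)) -
        T (k * (y' + v' + (a * (y + v) - (y + v) * a)) * h * (k * (x + u) * h)) +
      (T (x' * v) + T (x * v') - (T (y' * u) + T (y * u'))) := by
  rw [trace_conj_mul hT hk, trace_conj_mul hT hk]
  have e1 := hN _ (N.mul_mem hx' hy)
  have e2 := hN _ (N.mul_mem hy' hx)
  have e3 := hK _ (K.mul_mem hu' hv)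
  have e4 := hK _ (K.mul_mem hv' hu)
  have e5 := hN _ (N.mul_mem ha (N.mul_mem hx hy))
  have e6 := hN _ (N.mul_mem ha (N.mul_mem hy hx))
  have c (p q : A) : T (p * (a * q)) = T (a * (q * p)) := by rw [hT, mul_assoc]
  simp only [mul_add, add_mul, mul_sub, sub_mul, map_add, map_sub, mul_assoc, c, e1, e2, e3, e4,
    e5, e6, hT x v', hT y u', hT x' v, hT y' u]
  ring

/-- The part built from the connection changes by a total derivative when `G` is replaced by another
primitive `G'` of the same connection: `a` is the connection, `p, q` are its variations, and
`x, y, x', y'` are the values of `G⁻¹ δG` and `G'⁻¹ δG'`. -/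
lemma trace_commutator_wedge (hT : ∀ x y, T (x * y) = T (y * x)) (a p q x y x' y' : A) :
    T (p * y) - T (q * x) - (T (p * y') - T (q * x')) =
      T ((p - (a * x' - x' * a)) * y) + T (x' * (q - (a * y - y * a))) -
        (T ((q - (a * y' - y' * a)) * x) + T (y' * (p - (a * x - x * a)))) := by
  have c (p q : A) : T (p * (q * a)) = T (a * (p * q)) := by rw [← mul_assoc, hT]
  have c' (p q : A) : T (p * (a * q)) = T (a * (q * p)) := by rw [hT, mul_assoc]
  simp only [mul_sub, sub_mul, map_sub, mul_assoc, c, c', hT x' q, hT y' p]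
  ring

end TraceIdentities

/-! ### The trace and the two isotropic subalgebras -/

section DAlgebra
variable {σ : ℤˣ} {Λ : ℝ}

/-- The linear functional `-4σ` times the `θ`-component of the scalar part, so that the pairing of
`x` and `y` is its value on `x * y`.  It is a trace, and it vanishes on the real spans of `1, J_I` and
of `1, τ_I`; isotropy and invariance of the pairing are used in this form. -/
def thetaTrace (σ : ℤˣ) (Λ : ℝ) : DAlg σ Λ →ₗ[ℝ] ℝ :=
  (-4 * sgn σ) • (LinearMap.proj 1 ∘ₗ coords σ Λ)

lemma thetaTrace_apply (x : DAlg σ Λ) : thetaTrace σ Λ x = -4 * sgn σ * x.re.im := rfl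

lemma pairing_apply (x y : DAlg σ Λ) : pairing σ Λ x y = thetaTrace σ Λ (x * y) := rfl

lemma thetaTrace_mul_comm (x y : DAlg σ Λ) :
    thetaTrace σ Λ (x * y) = thetaTrace σ Λ (y * x) := by
  rw [thetaTrace_apply, thetaTrace_apply]
  congr 1
  simp
  ring

/-- The real subalgebra spanned by `1, J_I`; it contains `SU` and its Lie algebra. -/
def suAlg (σ : ℤˣ) (Λ : ℝ) : Subalgebra ℝ (DAlg σ Λ) where
  carrier := {u | ∃ (r : ℝ) (x : Fin 3 → ℝ), u = r • 1 + ∑ I, x I • J σ Λ I}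
  mul_mem' := by
    rintro _ _ ⟨r, x, rfl⟩ ⟨s, y, rfl⟩
    exact ⟨_, _, su_mul r s x y⟩
  add_mem' := by
    rintro _ _ ⟨r, x, rfl⟩ ⟨s, y, rfl⟩
    refine ⟨r + s, x + y, ?_⟩
    simp only [Pi.add_apply, add_smul, Finset.sum_add_distrib]
    abel
  algebraMap_mem' r := ⟨r, 0, by simp [Algebra.algebraMap_eq_smul_one]⟩

/-- The real subalgebra spanned by `1, τ_I`; it contains `AN` and its Lie algebra. -/
def anAlg (σ : ℤˣ) (Λ : ℝ) : Subalgebra ℝ (DAlg σ Λ) where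
  carrier := {u | ∃ (r : ℝ) (x : Fin 3 → ℝ), u = r • 1 + ∑ I, x I • tau σ Λ I}
  mul_mem' := by
    rintro _ _ ⟨r, x, rfl⟩ ⟨s, y, rfl⟩
    exact ⟨_, _, an_mul r s x y⟩
  add_mem' := by
    rintro _ _ ⟨r, x, rfl⟩ ⟨s, y, rfl⟩
    refine ⟨r + s, x + y, ?_⟩
    simp only [Pi.add_apply, add_smul, Finset.sum_add_distrib]
    abel
  algebraMap_mem' r := ⟨r, 0, by simp [Algebra.algebraMap_eq_smul_one]⟩

lemma thetaTrace_suAlg (x : DAlg σ Λ) (hx : x ∈ suAlg σ Λ) : thetaTrace σ Λ x = 0 := by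
  obtain ⟨r, x, rfl⟩ := hx
  rw [su_mk, thetaTrace_apply, mul_zero]

lemma thetaTrace_anAlg (x : DAlg σ Λ) (hx : x ∈ anAlg σ Λ) : thetaTrace σ Λ x = 0 := by
  obtain ⟨r, x, rfl⟩ := hx
  rw [an_mk, thetaTrace_apply, mul_zero]

lemma star_mem_suAlg {x : DAlg σ Λ} (hx : x ∈ suAlg σ Λ) : star x ∈ suAlg σ Λ := by
  obtain ⟨r, x, rfl⟩ := hx
  exact ⟨r, -x, star_su r x⟩

lemma star_mem_anAlg {x : DAlg σ Λ} (hx : x ∈ anAlg σ Λ) : star x ∈ anAlg σ Λ := by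
  obtain ⟨r, x, rfl⟩ := hx
  exact ⟨r, -x, star_an r x⟩

lemma mem_suAlg_of_mem {u : (DAlg σ Λ)ˣ} (hu : u ∈ SU σ Λ) : (u : DAlg σ Λ) ∈ suAlg σ Λ := hu.2

lemma mem_anAlg_of_mem {u : (DAlg σ Λ)ˣ} (hu : u ∈ AN σ Λ) : (u : DAlg σ Λ) ∈ anAlg σ Λ := by
  obtain ⟨-, r, x, -, h⟩ := hu
  exact ⟨r, x, h⟩

lemma inv_eq_star {u : (DAlg σ Λ)ˣ} (hu : (u : DAlg σ Λ) * star (u : DAlg σ Λ) = 1) :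
    ((u⁻¹ : (DAlg σ Λ)ˣ) : DAlg σ Λ) = star (u : DAlg σ Λ) := by
  rw [Units.inv_eq_of_mul_eq_one_right hu]

/-- Multiplication of the algebra as a continuous bilinear map. -/
def mulCLM (σ : ℤˣ) (Λ : ℝ) : DAlg σ Λ →L[ℝ] DAlg σ Λ →L[ℝ] DAlg σ Λ :=
  LinearMap.toContinuousBilinearMap (LinearMap.mul ℝ (DAlg σ Λ))

lemma mulCLM_apply (x y : DAlg σ Λ) : mulCLM σ Λ x y = x * y := rfl

/-- Quaternionic conjugation as a real linear map. -/
def starLM (σ : ℤˣ) (Λ : ℝ) : DAlg σ Λ →ₗ[ℝ] DAlg σ Λ where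
  toFun := star
  map_add' := star_add
  map_smul' c x := by
    ext <;> simp

/-- Quaternionic conjugation as a continuous linear map. -/
def starCLM (σ : ℤˣ) (Λ : ℝ) : DAlg σ Λ →L[ℝ] DAlg σ Λ :=
  LinearMap.toContinuousLinearMap (starLM σ Λ)

/-- The functional `thetaTrace` as a continuous linear map. -/
def traceCLM (σ : ℤˣ) (Λ : ℝ) : DAlg σ Λ →L[ℝ] ℝ :=
  LinearMap.toContinuousLinearMap (thetaTrace σ Λ)

lemma traceCLM_apply (x : DAlg σ Λ) : traceCLM σ Λ x = thetaTrace σ Λ x := rfl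

end DAlgebra

/-! ### Logarithmic derivatives of functions of norm one -/

section Calculus
variable {σ : ℤˣ} {Λ : ℝ} {E : Type*} [NormedAddCommGroup E] [NormedSpace ℝ E] {Q : Set E}

/-- The derivative of `u` within `Q` in the constant direction `e`, as a function of the point.
Derivatives are taken within `Q` because the edge parameter runs over a closed interval. -/
def dirDeriv {W : Type*} [NormedAddCommGroup W] [NormedSpace ℝ W] (Q : Set E) (u : E → W)
    (e q : E) : W :=
  fderivWithin ℝ u Q q e

lemma contDiffOn_dirDeriv {W : Type*} [NormedAddCommGroup W] [NormedSpace ℝ W]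
    (hQ : UniqueDiffOn ℝ Q) {u : E → W} (hu : ContDiffOn ℝ ∞ u Q) (e : E) :
    ContDiffOn ℝ ∞ (dirDeriv Q u e) Q :=
  (hu.fderivWithin hQ (by simp)).clm_apply contDiffOn_const

lemma dirDeriv_congr {W : Type*} [NormedAddCommGroup W] [NormedSpace ℝ W] {u v : E → W}
    (h : EqOn u v Q) {q : E} (hq : q ∈ Q) (e : E) : dirDeriv Q u e q = dirDeriv Q v e q := by
  rw [dirDeriv, dirDeriv, fderivWithin_congr h (h hq)]

lemma dirDeriv_comm {W : Type*} [NormedAddCommGroup W] [NormedSpace ℝ W]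
    (hQ : UniqueDiffOn ℝ Q) (hQ' : Q ⊆ closure (interior Q)) {u : E → W}
    (hu : ContDiffOn ℝ ∞ u Q) {q : E} (hq : q ∈ Q) (e₁ e₂ : E) :
    dirDeriv Q (dirDeriv Q u e₁) e₂ q = dirDeriv Q (dirDeriv Q u e₂) e₁ q := by
  have hd : DifferentiableWithinAt ℝ (fderivWithin ℝ u Q) Q q :=
    ((hu.fderivWithin (m := ∞) hQ (by simp)).differentiableOn (by simp)) q hq
  have key (e e' : E) : dirDeriv Q (dirDeriv Q u e) e' q =
      fderivWithin ℝ (fderivWithin ℝ u Q) Q q e' e := by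
    have : dirDeriv Q u e = fun x => (fderivWithin ℝ u Q x) ((fun _ => e) x) := rfl
    rw [dirDeriv, this, fderivWithin_clm_apply (hQ q hq) hd (differentiableWithinAt_const _)]
    simp
  rw [key, key]
  exact ((hu q hq).isSymmSndFDerivWithinAt (n := ∞)
    (by rw [minSmoothness_of_isRCLikeNormedField]; exact ENat.LEInfty.out) hQ (hQ' hq) hq).eq _ _

lemma dirDeriv_clm {W W' : Type*} [NormedAddCommGroup W] [NormedSpace ℝ W]
    [NormedAddCommGroup W'] [NormedSpace ℝ W'] (hQ : UniqueDiffOn ℝ Q) (M : W →L[ℝ] W') {u : E → W}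
    (hu : ContDiffOn ℝ ∞ u Q) {q : E} (hq : q ∈ Q) (e : E) :
    dirDeriv Q (fun x => M (u x)) e q = M (dirDeriv Q u e q) := by
  have h := (hu.differentiableOn (by simp) q hq).hasFDerivWithinAt
  have h' : HasFDerivWithinAt (fun x => M (u x)) (M.comp (fderivWithin ℝ u Q q)) Q q :=
    M.hasFDerivAt.comp_hasFDerivWithinAt q h
  rw [dirDeriv, h'.fderivWithin (hQ q hq)]
  rfl

lemma _root_.ContDiffOn.dalg_mul {u v : E → DAlg σ Λ} {n : ℕ∞ω}
    (hu : ContDiffOn ℝ n u Q) (hv : ContDiffOn ℝ n v Q) :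
    ContDiffOn ℝ n (fun q => u q * v q) Q :=
  (mulCLM σ Λ).isBoundedBilinearMap.contDiff.comp_contDiffOn (hu.prodMk hv)

lemma _root_.ContDiffOn.dalg_star {u : E → DAlg σ Λ} {n : ℕ∞ω}
    (hu : ContDiffOn ℝ n u Q) : ContDiffOn ℝ n (fun q => star (u q)) Q :=
  (starCLM σ Λ).contDiff.comp_contDiffOn hu

lemma dirDeriv_mul (hQ : UniqueDiffOn ℝ Q) {u v : E → DAlg σ Λ} (hu : ContDiffOn ℝ ∞ u Q)
    (hv : ContDiffOn ℝ ∞ v Q) {q : E} (hq : q ∈ Q) (e : E) :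
    dirDeriv Q (fun x => u x * v x) e q = dirDeriv Q u e q * v q + u q * dirDeriv Q v e q := by
  have h := (mulCLM σ Λ).fderivWithin_of_bilinear (hu.differentiableOn (by simp) q hq)
    (hv.differentiableOn (by simp) q hq) (hQ q hq)
  simp only [mulCLM_apply] at h
  rw [dirDeriv, h, add_comm]
  rfl

lemma dirDeriv_star (hQ : UniqueDiffOn ℝ Q) {u : E → DAlg σ Λ} (hu : ContDiffOn ℝ ∞ u Q)
    {q : E} (hq : q ∈ Q) (e : E) :
    dirDeriv Q (fun x => star (u x)) e q = star (dirDeriv Q u e q) :=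
  dirDeriv_clm hQ (starCLM σ Λ) hu hq e

lemma dirDeriv_trace_mul (hQ : UniqueDiffOn ℝ Q) {u v : E → DAlg σ Λ} (hu : ContDiffOn ℝ ∞ u Q)
    (hv : ContDiffOn ℝ ∞ v Q) {q : E} (hq : q ∈ Q) (e : E) :
    dirDeriv Q (fun x => thetaTrace σ Λ (u x * v x)) e q =
      thetaTrace σ Λ (dirDeriv Q u e q * v q) + thetaTrace σ Λ (u q * dirDeriv Q v e q) := by
  have h := dirDeriv_clm hQ (traceCLM σ Λ) (hu.dalg_mul hv) hq e
  simp only [traceCLM_apply] at h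
  rw [h, dirDeriv_mul hQ hu hv hq, map_add]

lemma _root_.ContDiffOn.trace_mul {u v : E → DAlg σ Λ} {n : ℕ∞ω}
    (hu : ContDiffOn ℝ n u Q) (hv : ContDiffOn ℝ n v Q) :
    ContDiffOn ℝ n (fun x => thetaTrace σ Λ (u x * v x)) Q :=
  (traceCLM σ Λ).contDiff.comp_contDiffOn (hu.dalg_mul hv)

/-- Derivatives of a function with values in a linear subspace stay in that subspace. -/
lemma dirDeriv_mem (hQ : UniqueDiffOn ℝ Q) {u : E → DAlg σ Λ} (hu : ContDiffOn ℝ ∞ u Q)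
    (B : Submodule ℝ (DAlg σ Λ)) (hB : ∀ q ∈ Q, u q ∈ B) {q : E} (hq : q ∈ Q) (e : E) :
    dirDeriv Q u e q ∈ B := by
  -- `B` is the kernel of a continuous linear map, the projection onto a complement.
  obtain ⟨C, hC⟩ := B.exists_isCompl
  let π : DAlg σ Λ →L[ℝ] DAlg σ Λ := LinearMap.toContinuousLinearMap (C.projection B hC.symm)
  have hπ (x : DAlg σ Λ) : π x = 0 ↔ x ∈ B := by
    change C.projection B hC.symm x = 0 ↔ x ∈ B
    rw [← LinearMap.mem_ker, Submodule.ker_projection]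
  rw [← hπ, ← dirDeriv_clm hQ π hu hq e,
    dirDeriv_congr (v := fun _ => (0 : DAlg σ Λ)) (fun x hx => (hπ _).2 (hB x hx)) hq]
  simp [dirDeriv]

/-- A smooth function on `Q` with values of norm one, for which `star` is the inverse. -/
structure SmoothUnitary (Q : Set E) (u : E → DAlg σ Λ) : Prop where
  smooth : ContDiffOn ℝ ∞ u Q
  mul_star : ∀ q ∈ Q, u q * star (u q) = 1
  star_mul : ∀ q ∈ Q, star (u q) * u q = 1

lemma SmoothUnitary.mul {u v : E → DAlg σ Λ} (hu : SmoothUnitary Q u) (hv : SmoothUnitary Q v) :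
    SmoothUnitary Q (fun q => u q * v q) where
  smooth := hu.smooth.dalg_mul hv.smooth
  mul_star q hq := by
    rw [StarMul.star_mul, mul_assoc, ← mul_assoc (v q), hv.mul_star q hq, one_mul, hu.mul_star q hq]
  star_mul q hq := by
    rw [StarMul.star_mul, mul_assoc, ← mul_assoc (star (u q)), hu.star_mul q hq, one_mul,
      hv.star_mul q hq]

lemma SmoothUnitary.star {u : E → DAlg σ Λ} (hu : SmoothUnitary Q u) :
    SmoothUnitary Q (fun q => star (u q)) where
  smooth := hu.smooth.dalg_star
  mul_star q hq := by rw [star_star, hu.star_mul q hq]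
  star_mul q hq := by rw [star_star, hu.mul_star q hq]

/-- The left logarithmic derivative `u⁻¹ ∂_e u`, with `star u` for `u⁻¹`. -/
def logL (Q : Set E) (u : E → DAlg σ Λ) (e q : E) : DAlg σ Λ := star (u q) * dirDeriv Q u e q

/-- The right logarithmic derivative `∂_e u u⁻¹`, with `star u` for `u⁻¹`. -/
def logR (Q : Set E) (u : E → DAlg σ Λ) (e q : E) : DAlg σ Λ := dirDeriv Q u e q * star (u q)

variable {u v : E → DAlg σ Λ} {q : E}

lemma SmoothUnitary.contDiffOn_logL (hQ : UniqueDiffOn ℝ Q) (hu : SmoothUnitary Q u) (e : E) :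
    ContDiffOn ℝ ∞ (logL Q u e) Q :=
  hu.smooth.dalg_star.dalg_mul (contDiffOn_dirDeriv hQ hu.smooth e)

lemma SmoothUnitary.contDiffOn_logR (hQ : UniqueDiffOn ℝ Q) (hu : SmoothUnitary Q u) (e : E) :
    ContDiffOn ℝ ∞ (logR Q u e) Q :=
  (contDiffOn_dirDeriv hQ hu.smooth e).dalg_mul hu.smooth.dalg_star

lemma SmoothUnitary.star_dirDeriv (hQ : UniqueDiffOn ℝ Q) (hu : SmoothUnitary Q u) (hq : q ∈ Q)
    (e : E) :
    Star.star (dirDeriv Q u e q) = -(Star.star (u q) * dirDeriv Q u e q * Star.star (u q)) := by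
  have h1 := dirDeriv_mul hQ hu.smooth.dalg_star hu.smooth hq e
  rw [dirDeriv_congr (v := fun _ => (1 : DAlg σ Λ)) (fun x hx => hu.star_mul x hx) hq,
    dirDeriv_star hQ hu.smooth hq] at h1
  simp only [dirDeriv, fderivWithin_fun_const, Pi.zero_apply, zero_apply] at h1
  calc Star.star (dirDeriv Q u e q)
      = Star.star (dirDeriv Q u e q) * u q * Star.star (u q) := by
        rw [mul_assoc, hu.mul_star q hq, mul_one]
    _ = _ := by
        rw [← neg_mul]
        congr 1
        exact eq_neg_of_add_eq_zero_left h1.symm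

/-- The Maurer–Cartan equation for the left logarithmic derivative. -/
lemma SmoothUnitary.dirDeriv_logL (hQ : UniqueDiffOn ℝ Q) (hQ' : Q ⊆ closure (interior Q))
    (hu : SmoothUnitary Q u) (hq : q ∈ Q) (e₁ e₂ : E) :
    dirDeriv Q (logL Q u e₂) e₁ q = dirDeriv Q (logL Q u e₁) e₂ q +
      (logL Q u e₂ q * logL Q u e₁ q - logL Q u e₁ q * logL Q u e₂ q) := by
  have key (e e' : E) : dirDeriv Q (logL Q u e) e' q = -(logL Q u e' q * logL Q u e q) +
      Star.star (u q) * dirDeriv Q (dirDeriv Q u e) e' q := by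
    change dirDeriv Q (fun x => Star.star (u x) * dirDeriv Q u e x) e' q = _
    rw [dirDeriv_mul hQ hu.smooth.dalg_star (contDiffOn_dirDeriv hQ hu.smooth e) hq,
      dirDeriv_star hQ hu.smooth hq, hu.star_dirDeriv hQ hq, neg_mul]
    simp only [logL, mul_assoc]
  rw [key, key, dirDeriv_comm hQ hQ' hu.smooth hq e₁ e₂]
  abel

/-- The Maurer–Cartan equation for the right logarithmic derivative. -/
lemma SmoothUnitary.dirDeriv_logR (hQ : UniqueDiffOn ℝ Q) (hQ' : Q ⊆ closure (interior Q))
    (hu : SmoothUnitary Q u) (hq : q ∈ Q) (e₁ e₂ : E) :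
    dirDeriv Q (logR Q u e₂) e₁ q = dirDeriv Q (logR Q u e₁) e₂ q +
      (logR Q u e₁ q * logR Q u e₂ q - logR Q u e₂ q * logR Q u e₁ q) := by
  have key (e e' : E) : dirDeriv Q (logR Q u e) e' q = -(logR Q u e q * logR Q u e' q) +
      dirDeriv Q (dirDeriv Q u e) e' q * Star.star (u q) := by
    change dirDeriv Q (fun x => dirDeriv Q u e x * Star.star (u x)) e' q = _
    rw [dirDeriv_mul hQ (contDiffOn_dirDeriv hQ hu.smooth e) hu.smooth.dalg_star hq,
      dirDeriv_star hQ hu.smooth hq, hu.star_dirDeriv hQ hq, mul_neg, add_comm]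
    simp only [logR, mul_assoc]
  rw [key, key, dirDeriv_comm hQ hQ' hu.smooth hq e₁ e₂]
  abel

lemma SmoothUnitary.logL_mul (hQ : UniqueDiffOn ℝ Q) (hu : SmoothUnitary Q u)
    (hv : SmoothUnitary Q v) (hq : q ∈ Q) (e : E) :
    logL Q (fun x => u x * v x) e q =
      Star.star (v q) * (logL Q u e q + logR Q v e q) * v q := by
  rw [logL, dirDeriv_mul hQ hu.smooth hv.smooth hq, StarMul.star_mul]
  have h1 := hu.star_mul q hq
  have h2 := hv.star_mul q hq
  simp only [logL, logR, mul_add, add_mul, mul_assoc, h2, mul_one]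
  rw [← mul_assoc (Star.star (u q)) (u q), h1, one_mul]

end Calculus

/-! ### Two-forms from a trace, and the endpoint identities -/

section Wedge
variable {A : Type*} [Ring A] [Algebra ℝ A] {T : A →ₗ[ℝ] ℝ} {E : Type*}

/-- The two-form `⟨α ∧ β⟩` on two vectors, for the pairing `(a, b) ↦ T (a * b)` given by a trace `T`.
The one-forms are plain functions: linearity plays no role. -/
def traceWedge (T : A →ₗ[ℝ] ℝ) (α β : E → A) (X Y : E) : ℝ := T (α X * β Y) - T (α Y * β X)

/-- The boundary term at one endpoint.  With `k = h⁻¹`, `k' = h'⁻¹` and `r = H⁻¹ δH` for `H = h h'⁻¹`,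
it depends on `h, h'` only through `H`. -/
lemma traceWedge_endpoint (hT : ∀ x y, T (x * y) = T (y * x)) {K : Subalgebra ℝ A}
    (hK : ∀ x ∈ K, T x = 0) {h k h' k' : A} (hk : h * k = 1) (hk' : k' * h' = 1) (hk'' : h' * k' = 1)
    (x x' u u' r : E → A) (hu' : ∀ e, u' e ∈ K) (hr : ∀ e, r e ∈ K)
    (hru : ∀ e, r e = h' * (k * u e * h) * k' - u' e) (X Y : E) :
    traceWedge T x u X Y - traceWedge T x' u' X Y +
        traceWedge T (fun e => k' * (x' e + u' e) * h') (fun e => k * (x e + u e) * h) X Y =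
      traceWedge T x' (fun e => h' * (k * x e * h) * k') X Y + traceWedge T x' r X Y +
        traceWedge T (fun e => h' * (k * x e * h) * k') r X Y := by
  have e1 (a b : E) : T (u' a * u' b) = 0 := hK _ (K.mul_mem (hu' a) (hu' b))
  have e2 (a b : E) : T (u' a * r b) = 0 := hK _ (K.mul_mem (hu' a) (hr b))
  have e3 (a b : E) : T (x a * u b) = T (h' * (k * x a * h) * k' * (r b + u' b)) := by
    rw [hru, sub_add_cancel, trace_conj_mul hT hk', trace_conj_mul hT hk]
  have e4 (a b : E) : T (k' * (x' a + u' a) * h' * (k * (x b + u b) * h)) =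
      T ((x' a + u' a) * (h' * (k * x b * h) * k' + (r b + u' b))) := by
    rw [hru, sub_add_cancel, ← trace_conj_mul hT hk'' (x' a + u' a)]
    congr 2
    have : k' * (h' * (k * x b * h) * k' + h' * (k * u b * h) * k') * h' =
      (k' * h') * (k * (x b + u b) * h) * (k' * h') := by noncomm_ring
    rw [this, hk', one_mul, mul_one]
  simp only [traceWedge, e3, e4]
  generalize h' * (k * x X * h) * k' = a
  generalize h' * (k * x Y * h) * k' = b
  simp only [mul_add, add_mul, map_add, e1, e2, hT a (u' Y), hT b (u' X)]
  ring

/-- The comparison of the two endpoints after everything has been conjugated to the first one: `hs` is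
the variation of the gluing element, and the vanishing traces express the isotropy of `𝔞𝔫`. -/
lemma traceWedge_ribbon_aux (hT : ∀ x y, T (x * y) = T (y * x)) {w z r p q s : E → A}
    (hs : ∀ e, z e + r e - w e = p e + s e - q e)
    (hzp : ∀ a b, T (z a * p b) = 0) (hww : ∀ a b, T (w a * w b) = 0)
    (hwq : ∀ a b, T (w a * q b) = 0) (hpp : ∀ a b, T (p a * p b) = 0) (X Y : E) :
    traceWedge T w z X Y + traceWedge T w r X Y + traceWedge T z r X Y
      - (traceWedge T q p X Y + traceWedge T q s X Y + traceWedge T p s X Y) =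
    traceWedge T r (fun e => p e - z e) X Y + traceWedge T s (fun e => q e - w e) X Y := by
  have hs' (e : E) : s e = z e + r e - w e - p e + q e := by rw [hs e]; abel
  have hpz (a b : E) : T (p a * z b) = 0 := by rw [hT, hzp]
  have hqw (a b : E) : T (q a * w b) = 0 := by rw [hT, hwq]
  simp only [traceWedge, hs', mul_add, add_mul, mul_sub, sub_mul, map_add, map_sub, hww, hwq,
    hpp, hpz, hqw, hT (z X) (r Y), hT (z Y) (r X), hT (q X) (p Y), hT (q Y) (p X),
    hT (q X) (r Y), hT (q Y) (r X), hT (w X) (r Y), hT (w Y) (r X), hT (q X) (z Y), hT (q Y) (z X),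
    hT (w X) (z Y), hT (w Y) (z X), hT (q Y) (q X),
    hT (r X) (p Y), hT (r Y) (p X)]
  ring

/-- The Heisenberg-double identity.  Given the ribbon relation `L H₁ = H₀ L'` and its variation `hr`, the
difference of the two endpoint terms is `⟨ΔH₀ ∧ ΔL⟩ + ⟨H₁⁻¹ δH₁ ∧ L'⁻¹ δL'⟩`.  The letters `K, M, M'`
denote inverses of `H, L, L'`, and `x, x', r` are the left logarithmic variations of `ℓ, ℓ', H`. -/
lemma traceWedge_ribbon (hT : ∀ x y, T (x * y) = T (y * x)) {N : Subalgebra ℝ A}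
    (hN : ∀ x ∈ N, T x = 0) {H₀ K₀ H₁ K₁ L M L' M' : A}
    (hHK₀ : H₀ * K₀ = 1) (hKH₀ : K₀ * H₀ = 1) (hHK₁ : H₁ * K₁ = 1)
    (hML : M * L = 1) (hLM' : L' * M' = 1) (hML' : M' * L' = 1)
    (hL : L ∈ N) (hM : M ∈ N) (hL' : L' ∈ N) (hM' : M' ∈ N)
    (ribbon : L * H₁ = H₀ * L') {x₀ x₁ x₀' x₁' r₀ r₁ : E → A}
    (hx₀ : ∀ e, x₀ e ∈ N) (hx₁ : ∀ e, x₁ e ∈ N) (hx₀' : ∀ e, x₀' e ∈ N) (hx₁' : ∀ e, x₁' e ∈ N)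
    (hr : ∀ e, K₀ * x₀ e * H₀ + r₀ e - x₀' e = L' * (K₁ * x₁ e * H₁ + r₁ e - x₁' e) * M')
    (X Y : E) :
    traceWedge T x₀' (fun e => K₀ * x₀ e * H₀) X Y + traceWedge T x₀' r₀ X Y +
        traceWedge T (fun e => K₀ * x₀ e * H₀) r₀ X Y -
      (traceWedge T x₁' (fun e => K₁ * x₁ e * H₁) X Y + traceWedge T x₁' r₁ X Y +
        traceWedge T (fun e => K₁ * x₁ e * H₁) r₁ X Y) =
    traceWedge T (fun e => H₀ * r₀ e * K₀) (fun e => L * x₁ e * M - x₀ e) X Y +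
      traceWedge T r₁ (fun e => x₁' e - M' * x₀' e * L') X Y := by
  have hKL : K₀ * L = L' * K₁ := by
    calc K₀ * L = K₀ * (L * H₁) * K₁ := by rw [mul_assoc, mul_assoc, hHK₁, mul_one]
      _ = L' * K₁ := by rw [ribbon, ← mul_assoc, hKH₀, one_mul]
  have hMH : M * H₀ = H₁ * M' := by
    calc M * H₀ = M * (H₀ * L') * M' := by rw [mul_assoc, mul_assoc, hLM', mul_one]
      _ = H₁ * M' := by rw [← ribbon, ← mul_assoc, hML, one_mul]
  -- Conjugation by `L'` after `H₁⁻¹` equals conjugation by `H₀⁻¹` after `L`.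
  have hP (e : E) : L' * (K₁ * x₁ e * H₁) * M' = K₀ * (L * x₁ e * M) * H₀ := by
    calc L' * (K₁ * x₁ e * H₁) * M' = L' * K₁ * x₁ e * (H₁ * M') := by noncomm_ring
      _ = K₀ * (L * x₁ e * M) * H₀ := by rw [← hKL, ← hMH]; noncomm_ring
  have cc (a b : A) : T (L' * a * M' * (L' * b * M')) = T (a * b) := trace_conj_mul hT hML' a b
  have c0 (a b : A) : T (K₀ * a * H₀ * (K₀ * b * H₀)) = T (a * b) := trace_conj_mul hT hHK₀ a b
  have aux := traceWedge_ribbon_aux hT (w := x₀') (z := fun e => K₀ * x₀ e * H₀) (r := r₀)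
    (p := fun e => L' * (K₁ * x₁ e * H₁) * M') (q := fun e => L' * x₁' e * M')
    (s := fun e => L' * r₁ e * M') (fun e => by rw [hr e]; noncomm_ring)
    (fun a b => by
      rw [hP, c0]
      exact hN _ (N.mul_mem (hx₀ a) (N.mul_mem (N.mul_mem hL (hx₁ b)) hM)))
    (fun a b => hN _ (N.mul_mem (hx₀' a) (hx₀' b)))
    (fun a b => hN _ (N.mul_mem (hx₀' a) (N.mul_mem (N.mul_mem hL' (hx₁' b)) hM')))
    (fun a b => by
      rw [hP, hP, c0]
      exact hN _ (N.mul_mem (N.mul_mem (N.mul_mem hL (hx₁ a)) hM)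
        (N.mul_mem (N.mul_mem hL (hx₁ b)) hM))) X Y
  have f1 (a b : E) : T (r₀ a * (L' * (K₁ * x₁ b * H₁) * M' - K₀ * x₀ b * H₀)) =
      T (H₀ * r₀ a * K₀ * (L * x₁ b * M - x₀ b)) := by
    rw [hP, ← trace_conj_mul hT hKH₀ (r₀ a)]
    congr 2
    calc _ = (H₀ * K₀) * (L * x₁ b * M) * (H₀ * K₀) - (H₀ * K₀) * x₀ b * (H₀ * K₀) := by
          noncomm_ring
      _ = _ := by simp only [hHK₀, one_mul, mul_one]
  have f2 (a b : E) : T (L' * r₁ a * M' * (L' * x₁' b * M' - x₀' b)) =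
      T (r₁ a * (x₁' b - M' * x₀' b * L')) := by
    rw [← cc (r₁ a)]
    congr 2
    calc _ = L' * x₁' b * M' - 1 * x₀' b * 1 := by rw [one_mul, mul_one]
      _ = _ := by rw [← hLM']; noncomm_ring
  simp only [traceWedge, cc, f1, f2] at aux ⊢
  exact aux

end Wedge

/-! ### The curl of the potential density -/

section Density
variable {σ : ℤˣ} {Λ : ℝ} {E : Type*} [NormedAddCommGroup E] [NormedSpace ℝ E] {Q : Set E}
  {l h l' h' : E → DAlg σ Λ} {q : E}

lemma dirDeriv_sub (hQ : UniqueDiffOn ℝ Q) {f g : E → ℝ} (hf : ContDiffOn ℝ ∞ f Q)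
    (hg : ContDiffOn ℝ ∞ g Q) (hq : q ∈ Q) (e : E) :
    dirDeriv Q (fun x => f x - g x) e q = dirDeriv Q f e q - dirDeriv Q g e q := by
  rw [dirDeriv, fderivWithin_fun_sub (hQ q hq) (hf.differentiableOn (by simp) q hq)
    (hg.differentiableOn (by simp) q hq)]
  rfl

lemma dirDeriv_add (hQ : UniqueDiffOn ℝ Q) {W : Type*} [NormedAddCommGroup W] [NormedSpace ℝ W]
    {f g : E → W} (hf : ContDiffOn ℝ ∞ f Q)
    (hg : ContDiffOn ℝ ∞ g Q) (hq : q ∈ Q) (e : E) :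
    dirDeriv Q (fun x => f x + g x) e q = dirDeriv Q f e q + dirDeriv Q g e q := by
  rw [dirDeriv, fderivWithin_fun_add (hQ q hq) (hf.differentiableOn (by simp) q hq)
    (hg.differentiableOn (by simp) q hq)]
  rfl

lemma contDiffOn_traceWedge {α β : E → E → DAlg σ Λ} (hα : ∀ e, ContDiffOn ℝ ∞ (α e) Q)
    (hβ : ∀ e, ContDiffOn ℝ ∞ (β e) Q) (X Y : E) :
    ContDiffOn ℝ ∞
      (fun x => traceWedge (thetaTrace σ Λ) (fun e => α e x) (fun e => β e x) X Y) Q :=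
  ((hα X).trace_mul (hβ Y)).sub ((hα Y).trace_mul (hβ X))

lemma dirDeriv_traceWedge (hQ : UniqueDiffOn ℝ Q) {α β : E → E → DAlg σ Λ}
    (hα : ∀ e, ContDiffOn ℝ ∞ (α e) Q)
    (hβ : ∀ e, ContDiffOn ℝ ∞ (β e) Q) (hq : q ∈ Q) (X Y e : E) :
    dirDeriv Q (fun x => traceWedge (thetaTrace σ Λ) (fun e => α e x) (fun e => β e x) X Y) e q =
      thetaTrace σ Λ (dirDeriv Q (α X) e q * β Y q) + thetaTrace σ Λ (α X q * dirDeriv Q (β Y) e q)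
      - (thetaTrace σ Λ (dirDeriv Q (α Y) e q * β X q) +
        thetaTrace σ Λ (α Y q * dirDeriv Q (β X) e q)) := by
  simp only [traceWedge]
  rw [dirDeriv_sub hQ ((hα X).trace_mul (hβ Y)) ((hα Y).trace_mul (hβ X)) hq,
    dirDeriv_trace_mul hQ (hα X) (hβ Y) hq, dirDeriv_trace_mul hQ (hα Y) (hβ X) hq]

/-- The `(X, Y)`-component of the exterior derivative of `e ↦ ⟨l⁻¹ ∂_τ l, ∂_e h h⁻¹⟩`. -/
def curl (Q : Set E) (l h : E → DAlg σ Λ) (τ X Y q : E) : ℝ :=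
  dirDeriv Q (fun x => thetaTrace σ Λ (logL Q l τ x * logR Q h Y x)) X q -
    dirDeriv Q (fun x => thetaTrace σ Λ (logL Q l τ x * logR Q h X x)) Y q

/-- Covariant form of the variation of the connection `(l h)⁻¹ ∂_τ (l h)`: it is the conjugate by `h` of
`∂_τ (l⁻¹ ∂_e l + ∂_e h h⁻¹)` plus a commutator with `l⁻¹ ∂_τ l`. -/
lemma SmoothUnitary.dirDeriv_logL_mul (hQ : UniqueDiffOn ℝ Q) (hQ' : Q ⊆ closure (interior Q))
    (hl : SmoothUnitary Q l) (hh : SmoothUnitary Q h) (hq : q ∈ Q) (τ e : E) :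
    dirDeriv Q (logL Q (fun x => l x * h x) τ) e q =
      Star.star (h q) * (dirDeriv Q (logL Q l e) τ q + dirDeriv Q (logR Q h e) τ q +
        (logL Q l τ q * (logL Q l e q + logR Q h e q) -
          (logL Q l e q + logR Q h e q) * logL Q l τ q)) * h q := by
  have hM : ContDiffOn ℝ ∞ (fun x => logL Q l e x + logR Q h e x) Q :=
    (hl.contDiffOn_logL hQ e).add (hh.contDiffOn_logR hQ e)
  rw [(hl.mul hh).dirDeriv_logL hQ hQ' hq, hl.logL_mul hQ hh hq, hl.logL_mul hQ hh hq,
    dirDeriv_congr (v := fun x => Star.star (h x) * (logL Q l e x + logR Q h e x) * h x)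
      (fun x hx => hl.logL_mul hQ hh hx e) hq,
    dirDeriv_mul hQ (hh.smooth.dalg_star.dalg_mul hM) hh.smooth hq,
    dirDeriv_mul hQ hh.smooth.dalg_star hM hq, dirDeriv_star hQ hh.smooth hq,
    hh.star_dirDeriv hQ hq,
    dirDeriv_add hQ (hl.contDiffOn_logL hQ e) (hh.contDiffOn_logR hQ e) hq]
  have hd : dirDeriv Q h τ q = logR Q h τ q * h q := by
    rw [logR, mul_assoc, hh.star_mul q hq, mul_one]
  have h1 : h q * Star.star (h q) = 1 := hh.mul_star q hq
  have h2 (x : DAlg σ Λ) : h q * (Star.star (h q) * x) = x := by rw [← mul_assoc, h1, one_mul]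
  rw [hd]
  simp only [mul_add, add_mul, mul_sub, sub_mul, mul_assoc, h1, h2, mul_one, neg_mul]
  abel

lemma SmoothUnitary.logL_mem_anAlg (hQ : UniqueDiffOn ℝ Q) (hu : SmoothUnitary Q l)
    (huN : ∀ x ∈ Q, l x ∈ anAlg σ Λ) (hq : q ∈ Q) (e : E) : logL Q l e q ∈ anAlg σ Λ :=
  (anAlg σ Λ).mul_mem (star_mem_anAlg (huN q hq))
    (dirDeriv_mem hQ hu.smooth (anAlg σ Λ).toSubmodule huN hq e)

lemma SmoothUnitary.logL_mem_suAlg (hQ : UniqueDiffOn ℝ Q) (hu : SmoothUnitary Q h)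
    (huK : ∀ x ∈ Q, h x ∈ suAlg σ Λ) (hq : q ∈ Q) (e : E) : logL Q h e q ∈ suAlg σ Λ :=
  (suAlg σ Λ).mul_mem (star_mem_suAlg (huK q hq))
    (dirDeriv_mem hQ hu.smooth (suAlg σ Λ).toSubmodule huK hq e)

lemma SmoothUnitary.logR_mem_suAlg (hQ : UniqueDiffOn ℝ Q) (hu : SmoothUnitary Q h)
    (huK : ∀ x ∈ Q, h x ∈ suAlg σ Λ) (hq : q ∈ Q) (e : E) : logR Q h e q ∈ suAlg σ Λ :=
  (suAlg σ Λ).mul_mem (dirDeriv_mem hQ hu.smooth (suAlg σ Λ).toSubmodule huK hq e)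
    (star_mem_suAlg (huK q hq))

/-- The splitting of the curl of the potential density into a part that depends only on the product
`l h` and a derivative in the direction `τ`. -/
lemma two_mul_curl (hQ : UniqueDiffOn ℝ Q) (hQ' : Q ⊆ closure (interior Q))
    (hl : SmoothUnitary Q l) (hh : SmoothUnitary Q h) (hlN : ∀ x ∈ Q, l x ∈ anAlg σ Λ)
    (hhK : ∀ x ∈ Q, h x ∈ suAlg σ Λ) (hq : q ∈ Q) (τ X Y : E) :
    2 * curl Q l h τ X Y q =
      traceWedge (thetaTrace σ Λ) (fun e => dirDeriv Q (logL Q (fun x => l x * h x) τ) e q)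
        (fun e => logL Q (fun x => l x * h x) e q) X Y +
      dirDeriv Q (fun x => traceWedge (thetaTrace σ Λ) (fun e => logL Q l e x)
        (fun e => logR Q h e x) X Y) τ q := by
  have hL (e : E) (x : E) (hx : x ∈ Q) : logL Q l e x ∈ anAlg σ Λ := hl.logL_mem_anAlg hQ hlN hx e
  have hR (e : E) (x : E) (hx : x ∈ Q) : logR Q h e x ∈ suAlg σ Λ := hh.logR_mem_suAlg hQ hhK hx e
  have hL' (e : E) : dirDeriv Q (logL Q l e) τ q ∈ anAlg σ Λ :=
    dirDeriv_mem hQ (hl.contDiffOn_logL hQ e) (anAlg σ Λ).toSubmodule (hL e) hq τ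
  have hR' (e : E) : dirDeriv Q (logR Q h e) τ q ∈ suAlg σ Λ :=
    dirDeriv_mem hQ (hh.contDiffOn_logR hQ e) (suAlg σ Λ).toSubmodule (hR e) hq τ
  have key := two_mul_density (T := thetaTrace σ Λ) thetaTrace_mul_comm thetaTrace_anAlg
    thetaTrace_suAlg (hh.mul_star q hq) (hL τ q hq) (hL X q hq) (hL Y q hq) (hL' X) (hL' Y)
    (hR X q hq) (hR Y q hq) (hR' X) (hR' Y)
  rw [dirDeriv_traceWedge hQ (hl.contDiffOn_logL hQ) (hh.contDiffOn_logR hQ) hq]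
  simp only [traceWedge, hl.dirDeriv_logL_mul hQ hQ' hh hq, hl.logL_mul hQ hh hq]
  rw [← key, curl, dirDeriv_trace_mul hQ (hl.contDiffOn_logL hQ τ) (hh.contDiffOn_logR hQ Y) hq,
    dirDeriv_trace_mul hQ (hl.contDiffOn_logL hQ τ) (hh.contDiffOn_logR hQ X) hq,
    hl.dirDeriv_logL hQ hQ' hq X τ, hl.dirDeriv_logL hQ hQ' hq Y τ,
    hh.dirDeriv_logR hQ hQ' hq X Y, mul_add (logL Q l τ q), map_add]
  ring

/-- The two-form whose `τ`-derivative is twice the difference of the curls of two configurations with the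
same connection. -/
def boundaryForm (Q : Set E) (l h l' h' : E → DAlg σ Λ) (X Y q : E) : ℝ :=
  traceWedge (thetaTrace σ Λ) (fun e => logL Q l e q) (fun e => logR Q h e q) X Y -
    traceWedge (thetaTrace σ Λ) (fun e => logL Q l' e q) (fun e => logR Q h' e q) X Y +
    traceWedge (thetaTrace σ Λ) (fun e => logL Q (fun x => l' x * h' x) e q)
      (fun e => logL Q (fun x => l x * h x) e q) X Y

lemma contDiffOn_boundaryForm (hQ : UniqueDiffOn ℝ Q)
    (hl : SmoothUnitary Q l) (hh : SmoothUnitary Q h) (hl' : SmoothUnitary Q l')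
    (hh' : SmoothUnitary Q h') (X Y : E) :
    ContDiffOn ℝ ∞ (boundaryForm Q l h l' h' X Y) Q :=
  ((contDiffOn_traceWedge (hl.contDiffOn_logL hQ) (hh.contDiffOn_logR hQ) X Y).sub
    (contDiffOn_traceWedge (hl'.contDiffOn_logL hQ) (hh'.contDiffOn_logR hQ) X Y)).add
    (contDiffOn_traceWedge ((hl'.mul hh').contDiffOn_logL hQ) ((hl.mul hh).contDiffOn_logL hQ) X Y)

/-- For two primitives `g, g'` of the same connection, the connection parts of the curl differ by a total
derivative. -/
lemma traceWedge_sub_traceWedge (hQ : UniqueDiffOn ℝ Q) (hQ' : Q ⊆ closure (interior Q))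
    {g g' : E → DAlg σ Λ} (hg : SmoothUnitary Q g) (hg' : SmoothUnitary Q g') (τ : E)
    (hconn : EqOn (logL Q g τ) (logL Q g' τ) Q) (hq : q ∈ Q) (X Y : E) :
    traceWedge (thetaTrace σ Λ) (fun e => dirDeriv Q (logL Q g τ) e q)
        (fun e => logL Q g e q) X Y -
      traceWedge (thetaTrace σ Λ) (fun e => dirDeriv Q (logL Q g' τ) e q)
        (fun e => logL Q g' e q) X Y =
    dirDeriv Q (fun x => traceWedge (thetaTrace σ Λ) (fun e => logL Q g' e x)
      (fun e => logL Q g e x) X Y) τ q := by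
  have m (e : E) := hg.dirDeriv_logL hQ hQ' hq e τ
  have m' (e : E) := hg'.dirDeriv_logL hQ hQ' hq e τ
  have hd (e : E) := dirDeriv_congr hconn hq e
  rw [dirDeriv_traceWedge hQ (hg'.contDiffOn_logL hQ) (hg.contDiffOn_logL hQ) hq]
  simp only [traceWedge, ← hd]
  rw [trace_commutator_wedge thetaTrace_mul_comm (logL Q g τ q), sub_eq_of_eq_add (m X),
    sub_eq_of_eq_add (m Y), hd X, hd Y, hconn hq, sub_eq_of_eq_add (m' X),
    sub_eq_of_eq_add (m' Y)]

/-- For two configurations with the same connection in the direction `τ`, the curls of the potential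
densities differ by a total `τ`-derivative. -/
lemma two_mul_curl_sub_curl (hQ : UniqueDiffOn ℝ Q) (hQ' : Q ⊆ closure (interior Q))
    (hl : SmoothUnitary Q l) (hh : SmoothUnitary Q h) (hl' : SmoothUnitary Q l')
    (hh' : SmoothUnitary Q h') (hlN : ∀ x ∈ Q, l x ∈ anAlg σ Λ)
    (hhK : ∀ x ∈ Q, h x ∈ suAlg σ Λ) (hlN' : ∀ x ∈ Q, l' x ∈ anAlg σ Λ)
    (hhK' : ∀ x ∈ Q, h' x ∈ suAlg σ Λ) (τ : E)
    (hconn : EqOn (logL Q (fun x => l x * h x) τ) (logL Q (fun x => l' x * h' x) τ) Q)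
    (hq : q ∈ Q) (X Y : E) :
    2 * (curl Q l h τ X Y q - curl Q l' h' τ X Y q) =
      dirDeriv Q (boundaryForm Q l h l' h' X Y) τ q := by
  have c1 := contDiffOn_traceWedge (hl.contDiffOn_logL hQ) (hh.contDiffOn_logR hQ) X Y
  have c2 := contDiffOn_traceWedge (hl'.contDiffOn_logL hQ) (hh'.contDiffOn_logR hQ) X Y
  have c3 := contDiffOn_traceWedge ((hl'.mul hh').contDiffOn_logL hQ)
    ((hl.mul hh).contDiffOn_logL hQ) X Y
  have s1 : boundaryForm Q l h l' h' X Y = fun x =>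
    traceWedge (thetaTrace σ Λ) (fun e => logL Q l e x) (fun e => logR Q h e x) X Y -
      traceWedge (thetaTrace σ Λ) (fun e => logL Q l' e x) (fun e => logR Q h' e x) X Y +
      traceWedge (thetaTrace σ Λ) (fun e => logL Q (fun x => l' x * h' x) e x)
        (fun e => logL Q (fun x => l x * h x) e x) X Y := rfl
  rw [s1, dirDeriv_add hQ (c1.sub c2) c3 hq, dirDeriv_sub hQ c1 c2 hq,
    ← traceWedge_sub_traceWedge hQ hQ' (hl.mul hh) (hl'.mul hh') τ hconn hq,
    mul_sub, two_mul_curl hQ hQ' hl hh hlN hhK hq, two_mul_curl hQ hQ' hl' hh' hlN' hhK' hq,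
    add_sub_add_comm, add_comm]

end Density

/-! ### Integrals depending on parameters -/

section Parametric
open MeasureTheory Filter Topology

variable {F : Type*} [NormedAddCommGroup F] {U : Set F}

lemma prod_Icc_subset_closure_interior (hU : IsOpen U) :
    U ×ˢ Icc (0 : ℝ) 1 ⊆ closure (interior (U ×ˢ Icc (0 : ℝ) 1)) := by
  rw [interior_prod_eq, closure_prod_eq, hU.interior_eq, interior_Icc,
    closure_Ioo zero_ne_one]
  exact prod_mono subset_closure subset_rfl

lemma continuousOn_slice {W : Type*} [TopologicalSpace W] {Φ : F × ℝ → W}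
    (hΦ : ContinuousOn Φ (U ×ˢ Icc (0 : ℝ) 1)) {p : F} (hp : p ∈ U) :
    ContinuousOn (fun s => Φ (p, s)) (Icc 0 1) :=
  hΦ.comp (by fun_prop) (fun _ hs => ⟨hp, hs⟩)

lemma intervalIntegrable_slice {W : Type*} [NormedAddCommGroup W] {Φ : F × ℝ → W}
    (hΦ : ContinuousOn Φ (U ×ˢ Icc (0 : ℝ) 1))
    {p : F} (hp : p ∈ U) : IntervalIntegrable (fun s => Φ (p, s)) volume 0 1 :=
  ContinuousOn.intervalIntegrable_of_Icc zero_le_one (continuousOn_slice hΦ hp)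

variable [NormedSpace ℝ F] {W : Type*} [NormedAddCommGroup W] [NormedSpace ℝ W]

lemma uniqueDiffOn_prod_Icc (hU : IsOpen U) : UniqueDiffOn ℝ (U ×ˢ Icc (0 : ℝ) 1) :=
  hU.uniqueDiffOn.prod (uniqueDiffOn_Icc zero_lt_one)

variable {Φ : F × ℝ → W} {p : F} {t : ℝ}

lemma hasFDerivAt_slice (hU : IsOpen U) (hΦ : ContDiffOn ℝ ∞ Φ (U ×ˢ Icc (0 : ℝ) 1))
    (hp : p ∈ U) (ht : t ∈ Icc (0 : ℝ) 1) :
    HasFDerivAt (fun x => Φ (x, t))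
      ((fderivWithin ℝ Φ (U ×ˢ Icc (0 : ℝ) 1) (p, t)).comp (ContinuousLinearMap.inl ℝ F ℝ)) p := by
  have h := (hΦ.differentiableOn (by simp) (p, t) ⟨hp, ht⟩).hasFDerivWithinAt
  have h2 : HasFDerivWithinAt (fun x : F => (x, t)) (ContinuousLinearMap.inl ℝ F ℝ) U p :=
    (hasFDerivAt_prodMk_left p t).hasFDerivWithinAt
  have hm : MapsTo (fun x : F => (x, t)) U (U ×ˢ Icc (0 : ℝ) 1) := fun _ hx => ⟨hx, ht⟩
  exact (h.comp p h2 hm).hasFDerivAt (hU.mem_nhds hp)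

lemma fderiv_slice (hU : IsOpen U) (hΦ : ContDiffOn ℝ ∞ Φ (U ×ˢ Icc (0 : ℝ) 1))
    (hp : p ∈ U) (ht : t ∈ Icc (0 : ℝ) 1) (X : F) :
    fderiv ℝ (fun x => Φ (x, t)) p X = dirDeriv (U ×ˢ Icc (0 : ℝ) 1) Φ (X, 0) (p, t) := by
  rw [(hasFDerivAt_slice hU hΦ hp ht).fderiv]
  rfl

lemma hasDerivWithinAt_slice (hΦ : ContDiffOn ℝ ∞ Φ (U ×ˢ Icc (0 : ℝ) 1))
    (hp : p ∈ U) (ht : t ∈ Icc (0 : ℝ) 1) :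
    HasDerivWithinAt (fun s => Φ (p, s)) (dirDeriv (U ×ˢ Icc (0 : ℝ) 1) Φ (0, 1) (p, t))
      (Icc 0 1) t := by
  have h := (hΦ.differentiableOn (by simp) (p, t) ⟨hp, ht⟩).hasFDerivWithinAt
  have h2 : HasFDerivWithinAt (fun s : ℝ => (p, s)) (ContinuousLinearMap.inr ℝ F ℝ) (Icc 0 1) t :=
    (hasFDerivAt_prodMk_right p t).hasFDerivWithinAt
  exact (HasFDerivWithinAt.comp t h h2 (fun x hx => ⟨hp, hx⟩)).hasDerivWithinAt

lemma integral_dirDeriv_slice {f : F × ℝ → ℝ} (hU : IsOpen U)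
    (hf : ContDiffOn ℝ ∞ f (U ×ˢ Icc (0 : ℝ) 1)) (hp : p ∈ U) :
    ∫ t in (0 : ℝ)..1, dirDeriv (U ×ˢ Icc (0 : ℝ) 1) f (0, 1) (p, t) = f (p, 1) - f (p, 0) := by
  refine intervalIntegral.integral_eq_sub_of_hasDerivAt_of_le (f := fun t => f (p, t)) zero_le_one
    (continuousOn_slice hf.continuousOn hp) (fun t ht => ?_)
    (intervalIntegrable_slice
      (contDiffOn_dirDeriv (uniqueDiffOn_prod_Icc hU) hf (0, 1)).continuousOn hp)
  exact (hasDerivWithinAt_slice hf hp (Ioo_subset_Icc_self ht)).hasDerivAt (Icc_mem_nhds ht.1 ht.2)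

/-- Differentiation under the integral over `[0, 1]` of a function smooth on `U × [0, 1]`.  The space of
parameters need not be locally compact; the uniform bound near `p` comes from compactness of the
interval alone. -/
lemma hasFDerivAt_integral_slice (hU : IsOpen U) (hΦ : ContDiffOn ℝ ∞ Φ (U ×ˢ Icc (0 : ℝ) 1))
    (hp : p ∈ U) :
    HasFDerivAt (fun x => ∫ t in (0 : ℝ)..1, Φ (x, t))
      (∫ t in (0 : ℝ)..1, (fderivWithin ℝ Φ (U ×ˢ Icc (0 : ℝ) 1) (p, t)).comp
        (ContinuousLinearMap.inl ℝ F ℝ)) p := by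
  set Q := U ×ˢ Icc (0 : ℝ) 1 with hQdef
  let D : F × ℝ → F →L[ℝ] W := fun q => (fderivWithin ℝ Φ Q q).comp (ContinuousLinearMap.inl ℝ F ℝ)
  have hD : ContinuousOn D Q :=
    (hΦ.continuousOn_fderivWithin (uniqueDiffOn_prod_Icc hU) (by simp)).clm_comp continuousOn_const
  have hDp : ContinuousOn (fun t => D (p, t)) (Icc 0 1) := continuousOn_slice hD hp
  obtain ⟨M, hM⟩ := isCompact_Icc.exists_bound_of_continuousOn hDp
  -- Tube lemma around `{p} × [0, 1]`: the derivative is bounded uniformly in `t` for `x` near `p`.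
  have hev : ∀ᶠ x in 𝓝 p, ∀ t ∈ Icc (0 : ℝ) 1, (x, t) ∈ Q → ‖D (x, t)‖ < M + 1 := by
    refine isCompact_Icc.eventually_forall_of_forall_eventually
      (P := fun x t => (x, t) ∈ Q → ‖D (x, t)‖ < M + 1) fun t ht => ?_
    have h := (hD.norm (p, t) ⟨hp, ht⟩).eventually_lt_const
      (lt_of_le_of_lt (hM t ht) (lt_add_one M))
    exact eventually_nhdsWithin_iff.1 h
  have hUp : ∀ᶠ x in 𝓝 p, x ∈ U := hU.mem_nhds hp
  have hsub : uIoc (0 : ℝ) 1 ⊆ Icc 0 1 := by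
    rw [uIoc_of_le zero_le_one]; exact Ioc_subset_Icc_self
  refine intervalIntegral.hasFDerivAt_integral_of_dominated_of_fderiv_le (𝕜 := ℝ)
    (F := fun x t => Φ (x, t)) (F' := fun x t => D (x, t)) (bound := fun _ => M + 1)
    (hUp.and hev) ?_ ?_ ?_ ?_ ?_ ?_
  · filter_upwards [hUp] with x hx
    exact ((continuousOn_slice hΦ.continuousOn hx).mono hsub).aestronglyMeasurable
      measurableSet_uIoc
  · exact intervalIntegrable_slice hΦ.continuousOn hp
  · exact (hDp.mono hsub).aestronglyMeasurable measurableSet_uIoc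
  · exact Eventually.of_forall fun t ht x hx => (hx.2 t (hsub ht) ⟨hx.1, hsub ht⟩).le
  · exact intervalIntegrable_const
  · exact Eventually.of_forall fun t ht x hx => hasFDerivAt_slice hU hΦ hx.1 (hsub ht)

lemma fderiv_integral_slice_apply {Φ : F × ℝ → F →L[ℝ] ℝ} (hU : IsOpen U)
    (hΦ : ContDiffOn ℝ ∞ Φ (U ×ˢ Icc (0 : ℝ) 1)) (hp : p ∈ U) (X Y : F) :
    fderiv ℝ (fun x => ∫ t in (0 : ℝ)..1, Φ (x, t)) p X Y =
      ∫ t in (0 : ℝ)..1,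
        dirDeriv (U ×ˢ Icc (0 : ℝ) 1) (fun q => Φ q Y) (X, 0) (p, t) := by
  have hQ := uniqueDiffOn_prod_Icc hU
  have hD : ContinuousOn (fun q => (fderivWithin ℝ Φ (U ×ˢ Icc (0 : ℝ) 1) q).comp
      (ContinuousLinearMap.inl ℝ F ℝ)) (U ×ˢ Icc (0 : ℝ) 1) :=
    (hΦ.continuousOn_fderivWithin hQ (by simp)).clm_comp continuousOn_const
  have hi := intervalIntegrable_slice (W := F →L[ℝ] F →L[ℝ] ℝ) hD hp
  have hi' : IntervalIntegrable (fun t => (fderivWithin ℝ Φ (U ×ˢ Icc (0 : ℝ) 1) (p, t)).comp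
      (ContinuousLinearMap.inl ℝ F ℝ) X) volume 0 1 :=
    intervalIntegrable_slice (hD.clm_apply continuousOn_const) hp
  rw [(hasFDerivAt_integral_slice hU hΦ hp).fderiv,
    ContinuousLinearMap.intervalIntegral_apply hi, ContinuousLinearMap.intervalIntegral_apply hi']
  refine intervalIntegral.integral_congr fun t ht => ?_
  rw [uIcc_of_le zero_le_one] at ht
  exact (dirDeriv_clm hQ (ContinuousLinearMap.apply ℝ ℝ Y) hΦ
    (show (p, t) ∈ U ×ˢ Icc (0 : ℝ) 1 from ⟨hp, ht⟩) (X, 0)).symm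

end Parametric

/-! ### Boundary form and gluing element -/

section LogDerivatives
variable {σ : ℤˣ} {Λ : ℝ} {E : Type*} [NormedAddCommGroup E] [NormedSpace ℝ E] {Q : Set E}
  {l h l' h' u : E → DAlg σ Λ} {q : E}

lemma SmoothUnitary.logR_star (hQ : UniqueDiffOn ℝ Q) (hu : SmoothUnitary Q u) (hq : q ∈ Q)
    (e : E) : logR Q (fun x => Star.star (u x)) e q = -logL Q u e q := by
  rw [logR, dirDeriv_star hQ hu.smooth hq, hu.star_dirDeriv hQ hq, star_star, neg_mul, mul_assoc,
    hu.star_mul q hq, mul_one, logL]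

lemma SmoothUnitary.logL_eq (hu : SmoothUnitary Q u) (hq : q ∈ Q) (e : E) :
    logL Q u e q = Star.star (u q) * logR Q u e q * u q := by
  rw [logL, logR, mul_assoc, mul_assoc, hu.star_mul q hq, mul_one]

lemma SmoothUnitary.logR_eq (hu : SmoothUnitary Q u) (hq : q ∈ Q) (e : E) :
    logR Q u e q = u q * logL Q u e q * Star.star (u q) := by
  rw [logL, logR, ← mul_assoc, hu.mul_star q hq, one_mul]

lemma SmoothUnitary.logL_mul_star (hQ : UniqueDiffOn ℝ Q) (hh : SmoothUnitary Q h)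
    (hh' : SmoothUnitary Q h') (hq : q ∈ Q) (e : E) :
    logL Q (fun x => h x * Star.star (h' x)) e q =
      h' q * (logL Q h e q - logL Q h' e q) * Star.star (h' q) := by
  rw [hh.logL_mul hQ hh'.star hq, hh'.logR_star hQ hq, star_star, sub_eq_add_neg]

/-- The boundary form written with `u = h h'⁻¹` in place of `h` and `h'`. -/
lemma boundaryForm_eq (hQ : UniqueDiffOn ℝ Q)
    (hl : SmoothUnitary Q l) (hh : SmoothUnitary Q h) (hl' : SmoothUnitary Q l')
    (hh' : SmoothUnitary Q h') (hhK : ∀ x ∈ Q, h x ∈ suAlg σ Λ) (hhK' : ∀ x ∈ Q, h' x ∈ suAlg σ Λ)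
    (hu : ∀ x, u x = h x * star (h' x)) (hq : q ∈ Q) (X Y : E) :
    boundaryForm Q l h l' h' X Y q =
      traceWedge (thetaTrace σ Λ) (fun e => logL Q l' e q)
        (fun e => star (u q) * logL Q l e q * u q) X Y +
      traceWedge (thetaTrace σ Λ) (fun e => logL Q l' e q) (fun e => logL Q u e q) X Y +
      traceWedge (thetaTrace σ Λ) (fun e => star (u q) * logL Q l e q * u q)
        (fun e => logL Q u e q) X Y := by
  obtain rfl : u = fun x => h x * star (h' x) := funext hu
  have hH := hh.mul hh'.star
  have hHK : ∀ x ∈ Q, h x * star (h' x) ∈ suAlg σ Λ := fun x hx =>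
    (suAlg σ Λ).mul_mem (hhK x hx) (star_mem_suAlg (hhK' x hx))
  have key := traceWedge_endpoint (T := thetaTrace σ Λ) thetaTrace_mul_comm thetaTrace_suAlg
    (hh.mul_star q hq) (hh'.star_mul q hq) (hh'.mul_star q hq) (fun e => logL Q l e q)
    (fun e => logL Q l' e q) (fun e => logR Q h e q) (fun e => logR Q h' e q)
    (fun e => logL Q (fun x => h x * star (h' x)) e q)
    (hh'.logR_mem_suAlg hQ hhK' hq) (hH.logL_mem_suAlg hQ hHK hq)
    (fun e => by
      rw [hh.logL_mul_star hQ hh' hq, ← hh.logL_eq hq, hh'.logR_eq hq, mul_sub, sub_mul]) X Y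
  have hZ (e : E) : star (h q * star (h' q)) * logL Q l e q * (h q * star (h' q)) =
      h' q * (star (h q) * logL Q l e q * h q) * star (h' q) := by
    rw [star_mul, star_star]
    simp only [mul_assoc]
  simp only [hZ, ← key, boundaryForm]
  simp only [traceWedge, hl.logL_mul hQ hh hq, hl'.logL_mul hQ hh' hq]

/-- The left logarithmic derivative of the gluing element `l u l'⁻¹`. -/
lemma SmoothUnitary.logL_gluing (hQ : UniqueDiffOn ℝ Q) (hl : SmoothUnitary Q l)
    (hu : SmoothUnitary Q u) (hl' : SmoothUnitary Q l') {g : E → DAlg σ Λ}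
    (hg : ∀ x, g x = l x * u x * Star.star (l' x)) (hq : q ∈ Q) (e : E) :
    logL Q g e q =
      l' q * (Star.star (u q) * logL Q l e q * u q + logL Q u e q - logL Q l' e q) *
        Star.star (l' q) := by
  obtain rfl : g = fun x => l x * u x * Star.star (l' x) := funext hg
  rw [(hl.mul hu).logL_mul_star hQ hl' hq, hl.logL_mul hQ hu hq, mul_add, add_mul,
    ← hu.logL_eq hq]

/-- If `g` and `g'` have the same connection in the direction `e`, then `g g'⁻¹` is constant in that
direction. -/
lemma SmoothUnitary.dirDeriv_mul_star_eq_zero (hQ : UniqueDiffOn ℝ Q) {g g' : E → DAlg σ Λ}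
    (hg : SmoothUnitary Q g) (hg' : SmoothUnitary Q g') (hq : q ∈ Q) {e : E}
    (hconn : logL Q g e q = logL Q g' e q) :
    dirDeriv Q (fun x => g x * Star.star (g' x)) e q = 0 := by
  have h1 := (hg.mul hg'.star).logL_eq hq e
  have h2 := hg.logL_mul_star hQ hg' hq e
  rw [hconn, sub_self, mul_zero, zero_mul, logL] at h2
  have h3 := (hg.mul hg'.star).mul_star q hq
  rw [← one_mul (dirDeriv _ _ _ _), ← h3, mul_assoc, h2, mul_zero]

end LogDerivatives

/-! ### Fields along an edge -/

section Cells
variable {F : Type*} [NormedAddCommGroup F] [NormedSpace ℝ F]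
  {S : Type*} [TopologicalSpace S] [ChartedSpace (EuclideanSpace ℝ (Fin 2)) S]
  {σ : ℤˣ} {Λ : ℝ} {U : Set F} {C C' : Set S}

lemma smoothUnitary_of_units {u : F → S → (DAlg σ Λ)ˣ} {V : Set S} {γ : ℝ → S}
    (hu : ContMDiffOn (𝓘(ℝ, F).prod (𝓡 2)) 𝓘(ℝ, DAlg σ Λ) ∞
      (fun q : F × S => (u q.1 q.2 : DAlg σ Λ)) (U ×ˢ V))
    (hγ : ContMDiffOn 𝓘(ℝ, ℝ) (𝓡 2) ∞ γ (Icc 0 1)) (hγV : MapsTo γ (Icc 0 1) V)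
    (h1 : ∀ p ∈ U, ∀ t ∈ Icc (0 : ℝ) 1, (u p (γ t) : DAlg σ Λ) * star (u p (γ t) : DAlg σ Λ) = 1) :
    SmoothUnitary (U ×ˢ Icc (0 : ℝ) 1) (fun q : F × ℝ => (u q.1 (γ q.2) : DAlg σ Λ)) where
  smooth := by
    rw [← contMDiffOn_iff_contDiffOn]
    have h2 : ContMDiffOn 𝓘(ℝ, F × ℝ) (𝓘(ℝ, F).prod (𝓡 2)) ∞ (fun q : F × ℝ => (q.1, γ q.2))
        (U ×ˢ Icc (0 : ℝ) 1) :=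
      contDiff_fst.contMDiff.contMDiffOn.prodMk
        (hγ.comp contDiff_snd.contMDiff.contMDiffOn fun q hq => hq.2)
    exact hu.comp h2 fun q hq => ⟨hq.1, hγV hq.2⟩
  mul_star q hq := h1 _ hq.1 _ hq.2
  star_mul q hq := by rw [← inv_eq_star (h1 _ hq.1 _ hq.2), Units.inv_mul]

namespace CellField

/-- The field `ℓ` along the edge, as a function of the parameters and of the edge coordinate. -/
def ellEdge (c : CellField σ Λ U C) (γ : ℝ → S) (q : F × ℝ) : DAlg σ Λ := c.ell q.1 (γ q.2)

/-- The field `h` along the edge, as a function of the parameters and of the edge coordinate. -/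
def holEdge (c : CellField σ Λ U C) (γ : ℝ → S) (q : F × ℝ) : DAlg σ Λ := c.hol q.1 (γ q.2)

variable (c : CellField σ Λ U C) (c' : CellField σ Λ U C') {γ : ℝ → S} {p : F} {t : ℝ}

lemma smoothUnitary_ellEdge (hγ : ContMDiffOn 𝓘(ℝ, ℝ) (𝓡 2) ∞ γ (Icc 0 1))
    (hγC : MapsTo γ (Icc 0 1) C) : SmoothUnitary (U ×ˢ Icc (0 : ℝ) 1) (c.ellEdge γ) :=
  smoothUnitary_of_units c.smooth_ell hγ (hγC.mono_right c.subset_nhd)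
    fun p hp _ ht => (c.ell_mem p hp _ (hγC ht)).1

lemma smoothUnitary_holEdge (hγ : ContMDiffOn 𝓘(ℝ, ℝ) (𝓡 2) ∞ γ (Icc 0 1))
    (hγC : MapsTo γ (Icc 0 1) C) : SmoothUnitary (U ×ˢ Icc (0 : ℝ) 1) (c.holEdge γ) :=
  smoothUnitary_of_units c.smooth_hol hγ (hγC.mono_right c.subset_nhd)
    fun p hp _ ht => (c.hol_mem p hp _ (hγC ht)).1

lemma ellEdge_mem (hγC : MapsTo γ (Icc 0 1) C) :
    ∀ q ∈ U ×ˢ Icc (0 : ℝ) 1, c.ellEdge γ q ∈ anAlg σ Λ :=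
  fun q hq => mem_anAlg_of_mem (c.ell_mem q.1 hq.1 _ (hγC hq.2))

lemma holEdge_mem (hγC : MapsTo γ (Icc 0 1) C) :
    ∀ q ∈ U ×ˢ Icc (0 : ℝ) 1, c.holEdge γ q ∈ suAlg σ Λ :=
  fun q hq => mem_suAlg_of_mem (c.hol_mem q.1 hq.1 _ (hγC hq.2))

lemma inv_ell (hp : p ∈ U) {x : S} (hx : x ∈ C) :
    (((c.ell p x)⁻¹ : (DAlg σ Λ)ˣ) : DAlg σ Λ) = star (c.ell p x : DAlg σ Λ) :=
  inv_eq_star (c.ell_mem p hp x hx).1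

lemma inv_hol (hp : p ∈ U) {x : S} (hx : x ∈ C) :
    (((c.hol p x)⁻¹ : (DAlg σ Λ)ˣ) : DAlg σ Λ) = star (c.hol p x : DAlg σ Λ) :=
  inv_eq_star (c.hol_mem p hp x hx).1

lemma ellForm_eq (hγ : ContMDiffOn 𝓘(ℝ, ℝ) (𝓡 2) ∞ γ (Icc 0 1))
    (hγC : MapsTo γ (Icc 0 1) C) (hp : p ∈ U) (ht : t ∈ Icc (0 : ℝ) 1) :
    c.ellForm γ p t = logL (U ×ˢ Icc (0 : ℝ) 1) (c.ellEdge γ) (0, 1) (p, t) := by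
  have h := (hasDerivWithinAt_slice (c.smoothUnitary_ellEdge hγ hγC).smooth hp ht).derivWithin
    (uniqueDiffOn_Icc zero_lt_one t ht)
  rw [logL, ← h, ellForm, c.inv_ell hp (hγC ht)]
  rfl

lemma connForm_eq (hγ : ContMDiffOn 𝓘(ℝ, ℝ) (𝓡 2) ∞ γ (Icc 0 1))
    (hγC : MapsTo γ (Icc 0 1) C) (hp : p ∈ U) (ht : t ∈ Icc (0 : ℝ) 1) :
    c.connForm γ p t =
      logL (U ×ˢ Icc (0 : ℝ) 1) (fun q => c.ellEdge γ q * c.holEdge γ q) (0, 1) (p, t) := by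
  have hG := (c.smoothUnitary_ellEdge hγ hγC).mul (c.smoothUnitary_holEdge hγ hγC)
  have h := (hasDerivWithinAt_slice hG.smooth hp ht).derivWithin
    (uniqueDiffOn_Icc zero_lt_one t ht)
  have hi : (((c.G p (γ t))⁻¹ : (DAlg σ Λ)ˣ) : DAlg σ Λ) =
      star ((c.ell p (γ t) : DAlg σ Λ) * (c.hol p (γ t) : DAlg σ Λ)) := by
    rw [inv_eq_star] <;> rw [G, Units.val_mul]
    have h1 := hG.mul_star (p, t) ⟨hp, ht⟩
    simpa only [ellEdge, holEdge] using h1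
  rw [logL, ← h, connForm, hi]
  simp only [G, Units.val_mul, ellEdge, holEdge]

/-- The potential density `⟨ℓ⁻¹ ∂_t ℓ, Δh⟩`, written with derivatives within `U × [0, 1]`; it agrees with
`integrand` there, and is visibly smooth. -/
def density (c : CellField σ Λ U C) (γ : ℝ → S) (q : F × ℝ) : F →L[ℝ] ℝ :=
  ((traceCLM σ Λ).comp (mulCLM σ Λ
    (logL (U ×ˢ Icc (0 : ℝ) 1) (c.ellEdge γ) (0, 1) q))).comp
  (((mulCLM σ Λ).flip (star (c.holEdge γ q))).comp
    ((fderivWithin ℝ (c.holEdge γ) (U ×ˢ Icc (0 : ℝ) 1) q).comp (ContinuousLinearMap.inl ℝ F ℝ)))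

lemma density_apply (q : F × ℝ) (X : F) :
    c.density γ q X = thetaTrace σ Λ (logL (U ×ˢ Icc (0 : ℝ) 1) (c.ellEdge γ) (0, 1) q *
      logR (U ×ˢ Icc (0 : ℝ) 1) (c.holEdge γ) (X, 0) q) := by
  simp only [density, ContinuousLinearMap.comp_apply, ContinuousLinearMap.flip_apply, mulCLM_apply,
    traceCLM_apply, ContinuousLinearMap.inl_apply, logR, dirDeriv]

lemma contDiffOn_density (hU : IsOpen U) (hγ : ContMDiffOn 𝓘(ℝ, ℝ) (𝓡 2) ∞ γ (Icc 0 1))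
    (hγC : MapsTo γ (Icc 0 1) C) :
    ContDiffOn ℝ ∞ (c.density γ) (U ×ˢ Icc (0 : ℝ) 1) := by
  have hQ := uniqueDiffOn_prod_Icc hU
  have hl := c.smoothUnitary_ellEdge hγ hγC
  have hh := c.smoothUnitary_holEdge hγ hγC
  have h1 : ContDiffOn ℝ ∞ (fun q => mulCLM σ Λ
      (logL (U ×ˢ Icc (0 : ℝ) 1) (c.ellEdge γ) (0, 1) q)) (U ×ˢ Icc (0 : ℝ) 1) :=
    (mulCLM σ Λ).contDiff.comp_contDiffOn (hl.contDiffOn_logL hQ (0, 1))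
  have h2 : ContDiffOn ℝ ∞ (fun q => (mulCLM σ Λ).flip (star (c.holEdge γ q)))
      (U ×ˢ Icc (0 : ℝ) 1) :=
    (mulCLM σ Λ).flip.contDiff.comp_contDiffOn hh.smooth.dalg_star
  exact (contDiffOn_const.clm_comp h1).clm_comp
    (h2.clm_comp ((hh.smooth.fderivWithin hQ (by simp)).clm_comp contDiffOn_const))

lemma integrand_eq (hU : IsOpen U) (hγ : ContMDiffOn 𝓘(ℝ, ℝ) (𝓡 2) ∞ γ (Icc 0 1))
    (hγC : MapsTo γ (Icc 0 1) C) (hp : p ∈ U) (ht : t ∈ Icc (0 : ℝ) 1) :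
    c.integrand γ p t = c.density γ (p, t) := by
  ext X
  have hf : fderiv ℝ (fun q => (c.hol q (γ t) : DAlg σ Λ)) p X = _ :=
    fderiv_slice hU (c.smoothUnitary_holEdge hγ hγC).smooth hp ht X
  rw [density_apply, ← c.ellForm_eq hγ hγC hp ht, logR, ← hf]
  change thetaTrace σ Λ (_ * (fderiv ℝ (fun q => (c.hol q (γ t) : DAlg σ Λ)) p X *
    (((c.hol p (γ t))⁻¹ : (DAlg σ Λ)ˣ) : DAlg σ Λ))) = _
  rw [c.inv_hol hp (hγC ht)]
  rfl

lemma intervalIntegrable_integrand (hU : IsOpen U) (hγ : ContMDiffOn 𝓘(ℝ, ℝ) (𝓡 2) ∞ γ (Icc 0 1))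
    (hγC : MapsTo γ (Icc 0 1) C) (hp : p ∈ U) :
    IntervalIntegrable (c.integrand γ p) MeasureTheory.volume 0 1 := by
  refine ContinuousOn.intervalIntegrable_of_Icc zero_le_one ?_
  exact (continuousOn_slice (c.contDiffOn_density hU hγ hγC).continuousOn hp).congr
    fun t ht => c.integrand_eq hU hγ hγC hp ht

lemma edgePotential_eq (hU : IsOpen U) (hγ : ContMDiffOn 𝓘(ℝ, ℝ) (𝓡 2) ∞ γ (Icc 0 1))
    (hγC : MapsTo γ (Icc 0 1) C) (hp : p ∈ U) :
    c.edgePotential γ p = ContinuousAlternatingMap.ofSubsingletonLIE (𝕜 := ℝ) (E := F) (F := ℝ)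
      (0 : Fin 1) (-∫ t in (0 : ℝ)..1, c.density γ (p, t)) := by
  have h : ∫ t in (0 : ℝ)..1, c.integrand γ p t = ∫ t in (0 : ℝ)..1, c.density γ (p, t) := by
    refine intervalIntegral.integral_congr fun t ht => ?_
    rw [uIcc_of_le zero_le_one] at ht
    exact c.integrand_eq hU hγ hγC hp ht
  rw [edgePotential, h]
  rfl

lemma differentiableAt_edgePotential (hU : IsOpen U)
    (hγ : ContMDiffOn 𝓘(ℝ, ℝ) (𝓡 2) ∞ γ (Icc 0 1))
    (hγC : MapsTo γ (Icc 0 1) C) (hp : p ∈ U) :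
    DifferentiableAt ℝ (c.edgePotential γ) p := by
  have h1 := (hasFDerivAt_integral_slice hU (c.contDiffOn_density hU hγ hγC) hp).differentiableAt
  have h2 := (ContinuousAlternatingMap.ofSubsingletonLIE (𝕜 := ℝ) (E := F) (F := ℝ)
    (0 : Fin 1)).differentiable.differentiableAt.comp p h1.neg
  refine h2.congr_of_eventuallyEq ?_
  filter_upwards [hU.mem_nhds hp] with x hx
  exact c.edgePotential_eq hU hγ hγC hx

lemma curl_edge (X Y : F) (q : F × ℝ) :
    curl (U ×ˢ Icc (0 : ℝ) 1) (c.ellEdge γ) (c.holEdge γ) (0, 1) (X, 0) (Y, 0) q =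
      dirDeriv (U ×ˢ Icc (0 : ℝ) 1) (fun q => c.density γ q Y) (X, 0) q -
      dirDeriv (U ×ˢ Icc (0 : ℝ) 1) (fun q => c.density γ q X) (Y, 0) q := by
  simp only [curl, density_apply]

lemma intervalIntegrable_dirDeriv_density (hU : IsOpen U)
    (hγ : ContMDiffOn 𝓘(ℝ, ℝ) (𝓡 2) ∞ γ (Icc 0 1)) (hγC : MapsTo γ (Icc 0 1) C) (hp : p ∈ U)
    (X Y : F) :
    IntervalIntegrable (fun t => dirDeriv (U ×ˢ Icc (0 : ℝ) 1)
      (fun q => c.density γ q Y) (X, 0) (p, t)) MeasureTheory.volume 0 1 :=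
  intervalIntegrable_slice (contDiffOn_dirDeriv (uniqueDiffOn_prod_Icc hU)
    ((c.contDiffOn_density hU hγ hγC).clm_apply contDiffOn_const) (X, 0)).continuousOn hp

lemma intervalIntegrable_curl (hU : IsOpen U)
    (hγ : ContMDiffOn 𝓘(ℝ, ℝ) (𝓡 2) ∞ γ (Icc 0 1)) (hγC : MapsTo γ (Icc 0 1) C) (hp : p ∈ U)
    (X Y : F) :
    IntervalIntegrable (fun t => curl (U ×ˢ Icc (0 : ℝ) 1) (c.ellEdge γ) (c.holEdge γ) (0, 1)
      (X, 0) (Y, 0) (p, t)) MeasureTheory.volume 0 1 := by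
  simp only [c.curl_edge]
  exact (c.intervalIntegrable_dirDeriv_density hU hγ hγC hp X Y).sub
    (c.intervalIntegrable_dirDeriv_density hU hγ hγC hp Y X)

/-- The edge contribution to the symplectic form is minus the integral of the curl of the density. -/
lemma edgeForm_apply (hU : IsOpen U) (hγ : ContMDiffOn 𝓘(ℝ, ℝ) (𝓡 2) ∞ γ (Icc 0 1))
    (hγC : MapsTo γ (Icc 0 1) C) (hp : p ∈ U) (X Y : F) :
    c.edgeForm γ p ![X, Y] = -∫ t in (0 : ℝ)..1,
      curl (U ×ˢ Icc (0 : ℝ) 1) (c.ellEdge γ) (c.holEdge γ) (0, 1) (X, 0) (Y, 0) (p, t) := by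
  have hd := c.contDiffOn_density hU hγ hγC
  have hdiff := (hasFDerivAt_integral_slice hU hd hp).differentiableAt
  have key (a b : F) : fderiv ℝ (fun x => c.edgePotential γ x ![b]) p a =
      -∫ t in (0 : ℝ)..1, dirDeriv (U ×ˢ Icc (0 : ℝ) 1)
        (fun q => c.density γ q b) (a, 0) (p, t) := by
    have he : (fun x => c.edgePotential γ x ![b]) =ᶠ[nhds p]
        fun x => -(∫ t in (0 : ℝ)..1, c.density γ (x, t)) b := by
      filter_upwards [hU.mem_nhds hp] with x hx
      rw [c.edgePotential_eq hU hγ hγC hx]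
      rfl
    rw [he.fderiv_eq, fderiv_fun_neg, ← fderiv_integral_slice_apply hU hd hp,
      fderiv_clm_apply hdiff (differentiableAt_const b)]
    simp
  rw [edgeForm, extDeriv_apply (c.differentiableAt_edgePotential hU hγ hγC hp)]
  have r0 : (0 : Fin 2).removeNth ![X, Y] = ![Y] := by
    ext i; fin_cases i; rfl
  have r1 : (1 : Fin 2).removeNth ![X, Y] = ![X] := by
    ext i; fin_cases i; rfl
  rw [Fin.sum_univ_two, r0, r1, key, key]
  simp only [c.curl_edge]
  rw [intervalIntegral.integral_sub (c.intervalIntegrable_dirDeriv_density hU hγ hγC hp X Y)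
    (c.intervalIntegrable_dirDeriv_density hU hγ hγC hp Y X)]
  simp
  ring

open scoped Pointwise in
lemma integrand_revEdge (γ : ℝ → S) (p : F) (t : ℝ) :
    c.integrand (revEdge γ) p t = -c.integrand γ p (1 - t) := by
  have h : c.ellForm (revEdge γ) p t = -c.ellForm γ p (1 - t) := by
    have hs : (1 : ℝ) +ᵥ -Icc (0 : ℝ) 1 = Icc (0 : ℝ) 1 := by
      rw [neg_Icc, ← image_vadd]
      simp [vadd_eq_add]
    have := derivWithin_comp_const_sub (f := fun s => (c.ell p (γ s) : DAlg σ Λ)) (a := (1 : ℝ))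
      (s := Icc (0 : ℝ) 1) (x := t)
    rw [hs] at this
    rw [ellForm, ellForm, ← mul_neg, ← this]
    rfl
  ext X
  simp only [integrand, h, map_neg]
  rfl

lemma edgePotential_revEdge (γ : ℝ → S) (p : F) :
    c.edgePotential (revEdge γ) p = -c.edgePotential γ p := by
  have h : ∫ t in (0 : ℝ)..1, c.integrand (revEdge γ) p t =
      -∫ t in (0 : ℝ)..1, c.integrand γ p t := by
    simp only [integrand_revEdge, intervalIntegral.integral_neg,
      intervalIntegral.integral_comp_sub_left (fun t => c.integrand γ p t), sub_self, sub_zero]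
  rw [edgePotential, h]
  ext v
  simp [edgePotential]

/-- Reversing the edge changes the sign; no regularity is needed, since both the derivative within
`[0, 1]` and the integral are equivariant under `t ↦ 1 - t`. -/
lemma edgeForm_revEdge (γ : ℝ → S) (p : F) :
    c.edgeForm (revEdge γ) p = -c.edgeForm γ p := by
  have h : c.edgePotential (revEdge γ) = (-1 : ℝ) • c.edgePotential γ := by
    ext1 x
    rw [c.edgePotential_revEdge γ x, Pi.smul_apply]
    exact (neg_one_smul ℝ _).symm
  rw [edgeForm, h, extDeriv_smul, edgeForm, neg_one_smul]

end CellField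
end Cells

/-! ### The link form -/

lemma eq_conj_of_conj_eq_conj {A : Type*} [Ring A] {m n m' n' a b : A} (hnm : n * m = 1)
    (h : m * a * n = m' * b * n') : a = n * m' * b * (n' * m) := by
  calc a = n * m * a * (n * m) := by rw [hnm, one_mul, mul_one]
    _ = n * (m * a * n) * m := by simp only [mul_assoc]
    _ = n * m' * b * (n' * m) := by rw [h]; simp only [mul_assoc]

section Link
variable {F : Type*} [NormedAddCommGroup F] [NormedSpace ℝ F]
  {S : Type*} [TopologicalSpace S] [ChartedSpace (EuclideanSpace ℝ (Fin 2)) S]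
  {σ : ℤˣ} {Λ : ℝ} {U : Set F} {C C' : Set S}

lemma varR_apply_of_eventuallyEq {u : F → (DAlg σ Λ)ˣ} {f : F → DAlg σ Λ} {p : F}
    (h : (fun q => (u q : DAlg σ Λ)) =ᶠ[nhds p] f) (hf : f p * star (f p) = 1) (X : F) :
    varR u p X = fderiv ℝ f p X * star (f p) := by
  have hp : (u p : DAlg σ Λ) = f p := h.self_of_nhds
  rw [← hp] at hf
  change fderiv ℝ (fun q => (u q : DAlg σ Λ)) p X * (((u p)⁻¹ : (DAlg σ Λ)ˣ) : DAlg σ Λ) = _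
  rw [inv_eq_star hf, h.fderiv_eq, hp]

lemma varL_apply_of_eventuallyEq {u : F → (DAlg σ Λ)ˣ} {f : F → DAlg σ Λ} {p : F}
    (h : (fun q => (u q : DAlg σ Λ)) =ᶠ[nhds p] f) (hf : f p * star (f p) = 1) (X : F) :
    varL u p X = star (f p) * fderiv ℝ f p X := by
  have hp : (u p : DAlg σ Λ) = f p := h.self_of_nhds
  rw [← hp] at hf
  change (((u p)⁻¹ : (DAlg σ Λ)ˣ) : DAlg σ Λ) * fderiv ℝ (fun q => (u q : DAlg σ Λ)) p X = _
  rw [inv_eq_star hf, h.fderiv_eq, hp]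

lemma fderiv_dalg_mul {f g : F → DAlg σ Λ} {p : F} (hf : DifferentiableAt ℝ f p)
    (hg : DifferentiableAt ℝ g p) (X : F) :
    fderiv ℝ (fun q => f q * g q) p X = fderiv ℝ f p X * g p + f p * fderiv ℝ g p X := by
  have h := (mulCLM σ Λ).fderiv_of_bilinear hf hg
  simp only [mulCLM_apply] at h
  rw [h, add_comm]
  rfl

namespace CellField

variable (c : CellField σ Λ U C) (c' : CellField σ Λ U C') {γ : ℝ → S} {p : F} {t : ℝ}

/-- The link holonomy `H = h_c h_{c'}⁻¹` along the edge. -/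
def linkEdge (c : CellField σ Λ U C) (c' : CellField σ Λ U C') (γ : ℝ → S) (q : F × ℝ) :
    DAlg σ Λ :=
  c.holEdge γ q * star (c'.holEdge γ q)

/-- The gluing element `G_c G_{c'}⁻¹ = ℓ_c H ℓ_{c'}⁻¹` along the edge. -/
def gluing (c : CellField σ Λ U C) (c' : CellField σ Λ U C') (γ : ℝ → S) (q : F × ℝ) :
    DAlg σ Λ :=
  c.ellEdge γ q * c.linkEdge c' γ q * star (c'.ellEdge γ q)

lemma linkEdge_apply (q : F × ℝ) :
    c.linkEdge c' γ q = c.holEdge γ q * star (c'.holEdge γ q) := rfl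

lemma gluing_apply (q : F × ℝ) :
    c.gluing c' γ q = c.ellEdge γ q * c.linkEdge c' γ q * star (c'.ellEdge γ q) := rfl

lemma smoothUnitary_linkEdge (hγ : ContMDiffOn 𝓘(ℝ, ℝ) (𝓡 2) ∞ γ (Icc 0 1))
    (hγC : MapsTo γ (Icc 0 1) C) (hγC' : MapsTo γ (Icc 0 1) C') :
    SmoothUnitary (U ×ˢ Icc (0 : ℝ) 1) (c.linkEdge c' γ) :=
  (c.smoothUnitary_holEdge hγ hγC).mul (c'.smoothUnitary_holEdge hγ hγC').star

lemma smoothUnitary_gluing (hγ : ContMDiffOn 𝓘(ℝ, ℝ) (𝓡 2) ∞ γ (Icc 0 1))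
    (hγC : MapsTo γ (Icc 0 1) C) (hγC' : MapsTo γ (Icc 0 1) C') :
    SmoothUnitary (U ×ˢ Icc (0 : ℝ) 1) (c.gluing c' γ) :=
  ((c.smoothUnitary_ellEdge hγ hγC).mul (c.smoothUnitary_linkEdge c' hγ hγC hγC')).mul
    (c'.smoothUnitary_ellEdge hγ hγC').star

/-- By the continuity equation the gluing element is constant along the edge. -/
lemma gluing_eq_gluing_zero (hU : IsOpen U) (hγ : ContMDiffOn 𝓘(ℝ, ℝ) (𝓡 2) ∞ γ (Icc 0 1))
    (hγC : MapsTo γ (Icc 0 1) C) (hγC' : MapsTo γ (Icc 0 1) C')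
    (hcont : ∀ t ∈ Icc (0 : ℝ) 1, c.connForm γ p t = c'.connForm γ p t) (hp : p ∈ U)
    (ht : t ∈ Icc (0 : ℝ) 1) : c.gluing c' γ (p, t) = c.gluing c' γ (p, 0) := by
  have hQ := uniqueDiffOn_prod_Icc hU
  have hG := (c.smoothUnitary_ellEdge hγ hγC).mul (c.smoothUnitary_holEdge hγ hγC)
  have hG' := (c'.smoothUnitary_ellEdge hγ hγC').mul (c'.smoothUnitary_holEdge hγ hγC')
  have hg := (c.smoothUnitary_gluing c' hγ hγC hγC').smooth
  have heq : c.gluing c' γ = fun q => c.ellEdge γ q * c.holEdge γ q *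
      star (c'.ellEdge γ q * c'.holEdge γ q) := by
    funext q
    rw [gluing, linkEdge, star_mul]
    simp only [mul_assoc]
  refine constant_of_derivWithin_zero (f := fun s => c.gluing c' γ (p, s))
    (fun s hs => (hasDerivWithinAt_slice hg hp hs).differentiableWithinAt) (fun s hs => ?_) t ht
  have hs' := Ico_subset_Icc_self hs
  rw [(hasDerivWithinAt_slice hg hp hs').derivWithin (uniqueDiffOn_Icc zero_lt_one s hs'), heq]
  refine hG.dirDeriv_mul_star_eq_zero hQ hG' ⟨hp, hs'⟩ ?_
  rw [← c.connForm_eq hγ hγC hp hs', ← c'.connForm_eq hγ hγC' hp hs', hcont s hs']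

lemma dirDeriv_gluing (hU : IsOpen U) (hγ : ContMDiffOn 𝓘(ℝ, ℝ) (𝓡 2) ∞ γ (Icc 0 1))
    (hγC : MapsTo γ (Icc 0 1) C) (hγC' : MapsTo γ (Icc 0 1) C')
    (hcont : ∀ p ∈ U, ∀ t ∈ Icc (0 : ℝ) 1, c.connForm γ p t = c'.connForm γ p t) (hp : p ∈ U)
    (ht : t ∈ Icc (0 : ℝ) 1) (X : F) :
    dirDeriv (U ×ˢ Icc (0 : ℝ) 1) (c.gluing c' γ) (X, 0) (p, t) =
      dirDeriv (U ×ˢ Icc (0 : ℝ) 1) (c.gluing c' γ) (X, 0) (p, 0) := by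
  have hg := (c.smoothUnitary_gluing c' hγ hγC hγC').smooth
  rw [← fderiv_slice hU hg hp ht, ← fderiv_slice hU hg hp (left_mem_Icc.2 zero_le_one)]
  have he : (fun x => c.gluing c' γ (x, t)) =ᶠ[nhds p] fun x => c.gluing c' γ (x, 0) := by
    filter_upwards [hU.mem_nhds hp] with x hx
    exact c.gluing_eq_gluing_zero c' hU hγ hγC hγC' (hcont x hx) hx ht
  rw [he.fderiv_eq]

/-- The triangular holonomy `ℓ(γ 0)⁻¹ ℓ(γ 1)` of the edge, with `star` as inverse. -/
def triEdge (c : CellField σ Λ U C) (γ : ℝ → S) (p : F) : DAlg σ Λ :=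
  star (c.ellEdge γ (p, 0)) * c.ellEdge γ (p, 1)

lemma triEdge_mul_star (hγ : ContMDiffOn 𝓘(ℝ, ℝ) (𝓡 2) ∞ γ (Icc 0 1))
    (hγC : MapsTo γ (Icc 0 1) C) (hp : p ∈ U) :
    c.triEdge γ p * star (c.triEdge γ p) = 1 := by
  have hl := c.smoothUnitary_ellEdge hγ hγC
  rw [triEdge, star_mul, star_star, mul_assoc, ← mul_assoc (c.ellEdge γ (p, 1)),
    hl.mul_star (p, 1) ⟨hp, right_mem_Icc.2 zero_le_one⟩, one_mul,
    hl.star_mul (p, 0) ⟨hp, left_mem_Icc.2 zero_le_one⟩]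

lemma star_mul_triEdge (hγ : ContMDiffOn 𝓘(ℝ, ℝ) (𝓡 2) ∞ γ (Icc 0 1))
    (hγC : MapsTo γ (Icc 0 1) C) (hp : p ∈ U) :
    star (c.triEdge γ p) * c.triEdge γ p = 1 := by
  have hl := c.smoothUnitary_ellEdge hγ hγC
  rw [triEdge, star_mul, star_star, mul_assoc, ← mul_assoc (c.ellEdge γ (p, 0)),
    hl.mul_star (p, 0) ⟨hp, left_mem_Icc.2 zero_le_one⟩, one_mul,
    hl.star_mul (p, 1) ⟨hp, right_mem_Icc.2 zero_le_one⟩]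

lemma triEdge_mem (hγC : MapsTo γ (Icc 0 1) C) (hp : p ∈ U) :
    c.triEdge γ p ∈ anAlg σ Λ :=
  (anAlg σ Λ).mul_mem (star_mem_anAlg (c.ellEdge_mem hγC _ ⟨hp, left_mem_Icc.2 zero_le_one⟩))
    (c.ellEdge_mem hγC _ ⟨hp, right_mem_Icc.2 zero_le_one⟩)

lemma fderiv_triEdge (hU : IsOpen U) (hγ : ContMDiffOn 𝓘(ℝ, ℝ) (𝓡 2) ∞ γ (Icc 0 1))
    (hγC : MapsTo γ (Icc 0 1) C) (hp : p ∈ U) (X : F) :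
    fderiv ℝ (c.triEdge γ) p X =
      c.triEdge γ p * logL (U ×ˢ Icc (0 : ℝ) 1) (c.ellEdge γ) (X, 0) (p, 1) -
        logL (U ×ˢ Icc (0 : ℝ) 1) (c.ellEdge γ) (X, 0) (p, 0) * c.triEdge γ p := by
  have hQ := uniqueDiffOn_prod_Icc hU
  have hl := c.smoothUnitary_ellEdge hγ hγC
  have h0 : (0 : ℝ) ∈ Icc (0 : ℝ) 1 := left_mem_Icc.2 zero_le_one
  have h1 : (1 : ℝ) ∈ Icc (0 : ℝ) 1 := right_mem_Icc.2 zero_le_one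
  have e : fderiv ℝ (c.triEdge γ) p X = _ :=
    fderiv_dalg_mul (hasFDerivAt_slice hU hl.star.smooth hp h0).differentiableAt
      (hasFDerivAt_slice hU hl.smooth hp h1).differentiableAt X
  rw [e, fderiv_slice hU hl.star.smooth hp h0, fderiv_slice hU hl.smooth hp h1,
    dirDeriv_star hQ hl.smooth ⟨hp, h0⟩, hl.star_dirDeriv hQ ⟨hp, h0⟩, triEdge, logL, logL]
  have h2 : c.ellEdge γ (p, 1) * (star (c.ellEdge γ (p, 1)) *
      dirDeriv (U ×ˢ Icc (0 : ℝ) 1) (c.ellEdge γ) (X, 0) (p, 1)) =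
      dirDeriv (U ×ˢ Icc (0 : ℝ) 1) (c.ellEdge γ) (X, 0) (p, 1) := by
    rw [← mul_assoc, hl.mul_star _ ⟨hp, h1⟩, one_mul]
  simp only [mul_assoc, h2, neg_mul]
  abel

lemma L_eventuallyEq (hU : IsOpen U) (hγC : MapsTo γ (Icc 0 1) C) (hp : p ∈ U) :
    (fun q => (c.L (γ 0) (γ 1) q : DAlg σ Λ)) =ᶠ[nhds p] c.triEdge γ := by
  filter_upwards [hU.mem_nhds hp] with x hx
  rw [L, Units.val_mul, c.inv_ell hx (hγC (left_mem_Icc.2 zero_le_one)), triEdge, ellEdge, ellEdge]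

lemma H_eventuallyEq (hU : IsOpen U) (hγC' : MapsTo γ (Icc 0 1) C') (hp : p ∈ U)
    (ht : t ∈ Icc (0 : ℝ) 1) :
    (fun q => (c.H c' (γ t) q : DAlg σ Λ)) =ᶠ[nhds p] fun q => c.linkEdge c' γ (q, t) := by
  filter_upwards [hU.mem_nhds hp] with x hx
  rw [H, Units.val_mul, c'.inv_hol hx (hγC' ht), linkEdge, holEdge, holEdge]

/-- The ribbon relation is the equality of the gluing elements at the two endpoints. -/
lemma ribbon_edge (hU : IsOpen U) (hγ : ContMDiffOn 𝓘(ℝ, ℝ) (𝓡 2) ∞ γ (Icc 0 1))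
    (hγC : MapsTo γ (Icc 0 1) C) (hγC' : MapsTo γ (Icc 0 1) C')
    (hcont : ∀ t ∈ Icc (0 : ℝ) 1, c.connForm γ p t = c'.connForm γ p t) (hp : p ∈ U) :
    c.triEdge γ p * c.linkEdge c' γ (p, 1) = c.linkEdge c' γ (p, 0) * c'.triEdge γ p := by
  have h0 : (0 : ℝ) ∈ Icc (0 : ℝ) 1 := left_mem_Icc.2 zero_le_one
  have h1 : (1 : ℝ) ∈ Icc (0 : ℝ) 1 := right_mem_Icc.2 zero_le_one
  have hg := c.gluing_eq_gluing_zero c' hU hγ hγC hγC' hcont hp h1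
  have hl := (c.smoothUnitary_ellEdge hγ hγC).star_mul (p, 0) ⟨hp, h0⟩
  have hl' := (c'.smoothUnitary_ellEdge hγ hγC').star_mul (p, 1) ⟨hp, h1⟩
  rw [gluing, gluing] at hg
  rw [triEdge, triEdge]
  calc star (c.ellEdge γ (p, 0)) * c.ellEdge γ (p, 1) * c.linkEdge c' γ (p, 1)
      = star (c.ellEdge γ (p, 0)) * (c.ellEdge γ (p, 1) * c.linkEdge c' γ (p, 1) *
          star (c'.ellEdge γ (p, 1))) * c'.ellEdge γ (p, 1) := by
        simp only [mul_assoc, hl', mul_one]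
    _ = star (c.ellEdge γ (p, 0)) * c.ellEdge γ (p, 0) * (c.linkEdge c' γ (p, 0) *
          (star (c'.ellEdge γ (p, 0)) * c'.ellEdge γ (p, 1))) := by
        rw [hg]; simp only [mul_assoc]
    _ = _ := by rw [hl, one_mul]

/-- The variation of the ribbon relation, in the form needed by `traceWedge_ribbon`. -/
lemma gluing_variation (hU : IsOpen U) (hγ : ContMDiffOn 𝓘(ℝ, ℝ) (𝓡 2) ∞ γ (Icc 0 1))
    (hγC : MapsTo γ (Icc 0 1) C) (hγC' : MapsTo γ (Icc 0 1) C')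
    (hcont : ∀ p ∈ U, ∀ t ∈ Icc (0 : ℝ) 1, c.connForm γ p t = c'.connForm γ p t) (hp : p ∈ U)
    (X : F) :
    star (c.linkEdge c' γ (p, 0)) *
          logL (U ×ˢ Icc (0 : ℝ) 1) (c.ellEdge γ) (X, 0) (p, 0) * c.linkEdge c' γ (p, 0) +
        logL (U ×ˢ Icc (0 : ℝ) 1) (c.linkEdge c' γ) (X, 0) (p, 0) -
        logL (U ×ˢ Icc (0 : ℝ) 1) (c'.ellEdge γ) (X, 0) (p, 0) =
      c'.triEdge γ p * (star (c.linkEdge c' γ (p, 1)) *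
          logL (U ×ˢ Icc (0 : ℝ) 1) (c.ellEdge γ) (X, 0) (p, 1) * c.linkEdge c' γ (p, 1) +
        logL (U ×ˢ Icc (0 : ℝ) 1) (c.linkEdge c' γ) (X, 0) (p, 1) -
        logL (U ×ˢ Icc (0 : ℝ) 1) (c'.ellEdge γ) (X, 0) (p, 1)) * star (c'.triEdge γ p) := by
  have hQ := uniqueDiffOn_prod_Icc hU
  have h0 : (0 : ℝ) ∈ Icc (0 : ℝ) 1 := left_mem_Icc.2 zero_le_one
  have h1 : (1 : ℝ) ∈ Icc (0 : ℝ) 1 := right_mem_Icc.2 zero_le_one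
  have hl := c.smoothUnitary_ellEdge hγ hγC
  have hl' := c'.smoothUnitary_ellEdge hγ hγC'
  have hH := c.smoothUnitary_linkEdge c' hγ hγC hγC'
  have hlog : logL (U ×ˢ Icc (0 : ℝ) 1) (c.gluing c' γ) (X, 0) (p, 0) =
      logL (U ×ˢ Icc (0 : ℝ) 1) (c.gluing c' γ) (X, 0) (p, 1) := by
    rw [logL, logL, c.dirDeriv_gluing c' hU hγ hγC hγC' hcont hp h1,
      c.gluing_eq_gluing_zero c' hU hγ hγC hγC' (hcont p hp) hp h1]
  have k0 := hl.logL_gluing hQ hH hl' (c.gluing_apply c') (q := (p, 0)) ⟨hp, h0⟩ (X, 0)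
  have k1 := hl.logL_gluing hQ hH hl' (c.gluing_apply c') (q := (p, 1)) ⟨hp, h1⟩ (X, 0)
  rw [triEdge, star_mul, star_star]
  have hk := (k0.symm.trans hlog).trans k1
  have e0 := hl'.star_mul (p, 0) ⟨hp, h0⟩
  with_reducible_and_instances exact eq_conj_of_conj_eq_conj e0 hk

/-- The difference of the boundary forms at the endpoints is the Heisenberg-double two-form of the
triangular holonomies. -/
lemma boundaryForm_sub (hU : IsOpen U) (hγ : ContMDiffOn 𝓘(ℝ, ℝ) (𝓡 2) ∞ γ (Icc 0 1))
    (hγC : MapsTo γ (Icc 0 1) C) (hγC' : MapsTo γ (Icc 0 1) C')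
    (hcont : ∀ p ∈ U, ∀ t ∈ Icc (0 : ℝ) 1, c.connForm γ p t = c'.connForm γ p t) (hp : p ∈ U)
    (X Y : F) :
    boundaryForm (U ×ˢ Icc (0 : ℝ) 1) (c.ellEdge γ) (c.holEdge γ) (c'.ellEdge γ) (c'.holEdge γ)
        (X, 0) (Y, 0) (p, 0) -
      boundaryForm (U ×ˢ Icc (0 : ℝ) 1) (c.ellEdge γ) (c.holEdge γ) (c'.ellEdge γ) (c'.holEdge γ)
        (X, 0) (Y, 0) (p, 1) =
    pairWedge (varR (c.H c' (γ 0)) p) (varR (c.L (γ 0) (γ 1)) p) X Y +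
      pairWedge (varL (c.H c' (γ 1)) p) (varL (c'.L (γ 0) (γ 1)) p) X Y := by
  have hQ := uniqueDiffOn_prod_Icc hU
  have h0 : (0 : ℝ) ∈ Icc (0 : ℝ) 1 := left_mem_Icc.2 zero_le_one
  have h1 : (1 : ℝ) ∈ Icc (0 : ℝ) 1 := right_mem_Icc.2 zero_le_one
  have m0 : (p, (0 : ℝ)) ∈ U ×ˢ Icc (0 : ℝ) 1 := ⟨hp, h0⟩
  have m1 : (p, (1 : ℝ)) ∈ U ×ˢ Icc (0 : ℝ) 1 := ⟨hp, h1⟩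
  have hl := c.smoothUnitary_ellEdge hγ hγC
  have hl' := c'.smoothUnitary_ellEdge hγ hγC'
  have hh := c.smoothUnitary_holEdge hγ hγC
  have hh' := c'.smoothUnitary_holEdge hγ hγC'
  have hH := c.smoothUnitary_linkEdge c' hγ hγC hγC'
  have hlL (q) (hq : q ∈ U ×ˢ Icc (0 : ℝ) 1) (e) :=
    hl.logL_mem_anAlg hQ (c.ellEdge_mem hγC) hq e
  have hlL' (q) (hq : q ∈ U ×ˢ Icc (0 : ℝ) 1) (e) :=
    hl'.logL_mem_anAlg hQ (c'.ellEdge_mem hγC') hq e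
  have key := traceWedge_ribbon (T := thetaTrace σ Λ) (H₀ := c.linkEdge c' γ (p, 0))
    (K₀ := star (c.linkEdge c' γ (p, 0))) (H₁ := c.linkEdge c' γ (p, 1))
    (K₁ := star (c.linkEdge c' γ (p, 1))) (L := c.triEdge γ p) (M := star (c.triEdge γ p))
    (L' := c'.triEdge γ p) (M' := star (c'.triEdge γ p))
    (x₀ := fun e : F => logL (U ×ˢ Icc (0 : ℝ) 1) (c.ellEdge γ) (e, 0) (p, 0))
    (x₁ := fun e : F => logL (U ×ˢ Icc (0 : ℝ) 1) (c.ellEdge γ) (e, 0) (p, 1))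
    (x₀' := fun e : F => logL (U ×ˢ Icc (0 : ℝ) 1) (c'.ellEdge γ) (e, 0) (p, 0))
    (x₁' := fun e : F => logL (U ×ˢ Icc (0 : ℝ) 1) (c'.ellEdge γ) (e, 0) (p, 1))
    (r₀ := fun e : F => logL (U ×ˢ Icc (0 : ℝ) 1) (c.linkEdge c' γ) (e, 0) (p, 0))
    (r₁ := fun e : F => logL (U ×ˢ Icc (0 : ℝ) 1) (c.linkEdge c' γ) (e, 0) (p, 1))
    thetaTrace_mul_comm thetaTrace_anAlg
    (hH.mul_star _ m0) (hH.star_mul _ m0) (hH.mul_star _ m1)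
    (c.star_mul_triEdge hγ hγC hp) (c'.triEdge_mul_star hγ hγC' hp)
    (c'.star_mul_triEdge hγ hγC' hp) (c.triEdge_mem hγC hp)
    (star_mem_anAlg (c.triEdge_mem hγC hp)) (c'.triEdge_mem hγC' hp)
    (star_mem_anAlg (c'.triEdge_mem hγC' hp))
    -- Unification at a higher transparency would unfold the product of quaternions.
    (by with_reducible_and_instances exact c.ribbon_edge c' hU hγ hγC hγC' (hcont p hp) hp)
    (fun e : F => hlL _ m0 (e, 0)) (fun e : F => hlL _ m1 (e, 0))
    (fun e : F => hlL' _ m0 (e, 0)) (fun e : F => hlL' _ m1 (e, 0))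
    (by with_reducible_and_instances exact c.gluing_variation c' hU hγ hγC hγC' hcont hp) X Y
  have vH0 (e : F) : varR (c.H c' (γ 0)) p e = c.linkEdge c' γ (p, 0) *
      logL (U ×ˢ Icc (0 : ℝ) 1) (c.linkEdge c' γ) (e, 0) (p, 0) *
      star (c.linkEdge c' γ (p, 0)) := by
    rw [varR_apply_of_eventuallyEq (c.H_eventuallyEq c' hU hγC' hp h0) (hH.mul_star _ m0),
      fderiv_slice hU hH.smooth hp h0, ← hH.logR_eq m0, logR]
  have vH1 (e : F) : varL (c.H c' (γ 1)) p e =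
      logL (U ×ˢ Icc (0 : ℝ) 1) (c.linkEdge c' γ) (e, 0) (p, 1) := by
    rw [varL_apply_of_eventuallyEq (c.H_eventuallyEq c' hU hγC' hp h1) (hH.mul_star _ m1),
      fderiv_slice hU hH.smooth hp h1, logL]
  have vL (e : F) : varR (c.L (γ 0) (γ 1)) p e =
      c.triEdge γ p * logL (U ×ˢ Icc (0 : ℝ) 1) (c.ellEdge γ) (e, 0) (p, 1) *
        star (c.triEdge γ p) - logL (U ×ˢ Icc (0 : ℝ) 1) (c.ellEdge γ) (e, 0) (p, 0) := by
    have hm := c.triEdge_mul_star hγ hγC hp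
    rw [varR_apply_of_eventuallyEq (c.L_eventuallyEq hU hγC hp) hm,
      c.fderiv_triEdge hU hγ hγC hp, sub_mul, mul_assoc (logL _ _ _ (p, 0)), hm, mul_one]
  have vL' (e : F) : varL (c'.L (γ 0) (γ 1)) p e =
      logL (U ×ˢ Icc (0 : ℝ) 1) (c'.ellEdge γ) (e, 0) (p, 1) - star (c'.triEdge γ p) *
        logL (U ×ˢ Icc (0 : ℝ) 1) (c'.ellEdge γ) (e, 0) (p, 0) * c'.triEdge γ p := by
    have hm := c'.star_mul_triEdge hγ hγC' hp
    rw [varL_apply_of_eventuallyEq (c'.L_eventuallyEq hU hγC' hp)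
      (c'.triEdge_mul_star hγ hγC' hp), c'.fderiv_triEdge hU hγ hγC' hp, mul_sub,
      ← mul_assoc, hm, one_mul, ← mul_assoc]
  rw [boundaryForm_eq hQ hl hh hl' hh' (c.holEdge_mem hγC) (c'.holEdge_mem hγC')
      (c.linkEdge_apply c') m0,
    boundaryForm_eq hQ hl hh hl' hh' (c.holEdge_mem hγC) (c'.holEdge_mem hγC')
      (c.linkEdge_apply c') m1]
  simp only [traceWedge] at key ⊢
  simp only [pairWedge, pairing_apply, vH0, vH1, vL, vL']
  with_reducible_and_instances exact key

end CellField

lemma linkForm_eq_sub {c : CellField σ Λ U C} {c' : CellField σ Λ U C'} (γ : ℝ → S) (p : F) :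
    linkForm c c' γ p = c.edgeForm γ p - c'.edgeForm γ p := by
  rw [linkForm, c'.edgeForm_revEdge, sub_eq_add_neg]

/-- The difference of the two edge contributions localizes at the endpoints of the edge. -/
lemma edgeForm_sub_edgeForm (c : CellField σ Λ U C) (c' : CellField σ Λ U C') {γ : ℝ → S} {p : F}
    (hU : IsOpen U) (hγ : ContMDiffOn 𝓘(ℝ, ℝ) (𝓡 2) ∞ γ (Icc 0 1))
    (hγC : MapsTo γ (Icc 0 1) C) (hγC' : MapsTo γ (Icc 0 1) C')
    (hcont : ∀ p ∈ U, ∀ t ∈ Icc (0 : ℝ) 1, c.connForm γ p t = c'.connForm γ p t) (hp : p ∈ U)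
    (X Y : F) :
    c.edgeForm γ p ![X, Y] - c'.edgeForm γ p ![X, Y] = (1 / 2) *
      (boundaryForm (U ×ˢ Icc (0 : ℝ) 1) (c.ellEdge γ) (c.holEdge γ) (c'.ellEdge γ) (c'.holEdge γ)
        (X, 0) (Y, 0) (p, 0) -
      boundaryForm (U ×ˢ Icc (0 : ℝ) 1) (c.ellEdge γ) (c.holEdge γ) (c'.ellEdge γ) (c'.holEdge γ)
        (X, 0) (Y, 0) (p, 1)) := by
  have hQ := uniqueDiffOn_prod_Icc hU
  have hQ' := prod_Icc_subset_closure_interior hU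
  have hl := c.smoothUnitary_ellEdge hγ hγC
  have hl' := c'.smoothUnitary_ellEdge hγ hγC'
  have hh := c.smoothUnitary_holEdge hγ hγC
  have hh' := c'.smoothUnitary_holEdge hγ hγC'
  have hB := contDiffOn_boundaryForm hQ hl hh hl' hh' (X, 0) (Y, 0)
  have hconn : EqOn (logL (U ×ˢ Icc (0 : ℝ) 1) (fun q => c.ellEdge γ q * c.holEdge γ q) (0, 1))
      (logL (U ×ˢ Icc (0 : ℝ) 1) (fun q => c'.ellEdge γ q * c'.holEdge γ q) (0, 1))
      (U ×ˢ Icc (0 : ℝ) 1) := fun q hq => by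
    rw [← c.connForm_eq hγ hγC hq.1 hq.2, ← c'.connForm_eq hγ hγC' hq.1 hq.2,
      hcont _ hq.1 _ hq.2]
  have hcurl (t : ℝ) (ht : t ∈ uIcc (0 : ℝ) 1) :
      curl (U ×ˢ Icc (0 : ℝ) 1) (c.ellEdge γ) (c.holEdge γ) (0, 1) (X, 0) (Y, 0) (p, t) -
        curl (U ×ˢ Icc (0 : ℝ) 1) (c'.ellEdge γ) (c'.holEdge γ) (0, 1) (X, 0) (Y, 0) (p, t) =
      (1 / 2) * dirDeriv (U ×ˢ Icc (0 : ℝ) 1) (boundaryForm (U ×ˢ Icc (0 : ℝ) 1) (c.ellEdge γ)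
        (c.holEdge γ) (c'.ellEdge γ) (c'.holEdge γ) (X, 0) (Y, 0)) (0, 1) (p, t) := by
    rw [uIcc_of_le zero_le_one] at ht
    rw [← two_mul_curl_sub_curl hQ hQ' hl hh hl' hh' (c.ellEdge_mem hγC) (c.holEdge_mem hγC)
      (c'.ellEdge_mem hγC') (c'.holEdge_mem hγC') (0, 1) hconn ⟨hp, ht⟩]
    ring
  rw [c.edgeForm_apply hU hγ hγC hp, c'.edgeForm_apply hU hγ hγC' hp, neg_sub_neg, ← neg_sub,
    ← intervalIntegral.integral_sub (c.intervalIntegrable_curl hU hγ hγC hp X Y)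
      (c'.intervalIntegrable_curl hU hγ hγC' hp X Y),
    intervalIntegral.integral_congr hcurl, intervalIntegral.integral_const_mul,
    integral_dirDeriv_slice hU hB hp]
  ring

end Link

end LoopGravity

end

open LoopGravity in
theorem theorem1 {F : Type*} [NormedAddCommGroup F] [NormedSpace ℝ F]
    {S : Type*} [TopologicalSpace S] [ChartedSpace (EuclideanSpace ℝ (Fin 2)) S]
    [IsManifold (𝓡 2) ∞ S]
    (σ : ℤˣ) (Λ : ℝ) (hσΛ : ¬(σ = 1 ∧ 0 < Λ))
    (U : Set F) (hU : IsOpen U) (C C' : Set S)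
    (c : CellField σ Λ U C) (c' : CellField σ Λ U C')
    (γ : ℝ → S) (hγ : ContMDiffOn 𝓘(ℝ, ℝ) (𝓡 2) ∞ γ (Icc 0 1))
    (hγC : ∀ t ∈ Icc (0 : ℝ) 1, γ t ∈ C ∩ C')
    (v v' : S) (hv : γ 0 = v) (hv' : γ 1 = v')
    (hcont : ∀ p ∈ U, ∀ t ∈ Icc (0 : ℝ) 1, c.connForm γ p t = c'.connForm γ p t) :
    ∀ p ∈ U,
      (IntervalIntegrable (c.integrand γ p) MeasureTheory.volume 0 1 ∧
        IntervalIntegrable (c'.integrand γ p) MeasureTheory.volume 0 1) ∧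
      (DifferentiableAt ℝ (c.edgePotential γ) p ∧ DifferentiableAt ℝ (c'.edgePotential γ) p) ∧
      (c.L v v' p ∈ AN σ Λ ∧ c'.L v v' p ∈ AN σ Λ ∧
        c.H c' v p ∈ SU σ Λ ∧ c.H c' v' p ∈ SU σ Λ) ∧
      c.L v v' p * c.H c' v' p = c.H c' v p * c'.L v v' p ∧
      linkForm c c' γ p = c.edgeForm γ p - c'.edgeForm γ p ∧
      ∀ X Y : F, linkForm c c' γ p ![X, Y] =
        (1 / 2) * (pairWedge (varR (c.H c' v) p) (varR (c.L v v') p) X Y +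
          pairWedge (varL (c.H c' v') p) (varL (c'.L v v') p) X Y) := by
  subst hv hv'
  intro p hp
  have h0 : (0 : ℝ) ∈ Icc (0 : ℝ) 1 := left_mem_Icc.2 zero_le_one
  have h1 : (1 : ℝ) ∈ Icc (0 : ℝ) 1 := right_mem_Icc.2 zero_le_one
  have hC : MapsTo γ (Icc 0 1) C := fun t ht => (hγC t ht).1
  have hC' : MapsTo γ (Icc 0 1) C' := fun t ht => (hγC t ht).2
  refine ⟨⟨c.intervalIntegrable_integrand hU hγ hC hp, c'.intervalIntegrable_integrand hU hγ hC' hp⟩,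
    ⟨c.differentiableAt_edgePotential hU hγ hC hp, c'.differentiableAt_edgePotential hU hγ hC' hp⟩,
    ⟨?_, ?_, ?_, ?_⟩, ?_, linkForm_eq_sub γ p, fun X Y => ?_⟩
  · exact mul_mem (inv_mem (c.ell_mem p hp _ (hC h0))) (c.ell_mem p hp _ (hC h1))
  · exact mul_mem (inv_mem (c'.ell_mem p hp _ (hC' h0))) (c'.ell_mem p hp _ (hC' h1))
  · exact mul_mem (c.hol_mem p hp _ (hC h0)) (inv_mem (c'.hol_mem p hp _ (hC' h0)))
  · exact mul_mem (c.hol_mem p hp _ (hC h1)) (inv_mem (c'.hol_mem p hp _ (hC' h1)))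
  · have hL := (c.L_eventuallyEq hU hC hp).self_of_nhds
    have hL' := (c'.L_eventuallyEq hU hC' hp).self_of_nhds
    have hH0 := (c.H_eventuallyEq c' hU hC' hp h0).self_of_nhds
    have hH1 := (c.H_eventuallyEq c' hU hC' hp h1).self_of_nhds
    beta_reduce at hL hL' hH0 hH1
    apply Units.ext
    rw [Units.val_mul, Units.val_mul, hL, hL', hH0, hH1,
      c.ribbon_edge c' hU hγ hC hC' (hcont p hp) hp]
  · rw [linkForm_eq_sub, ContinuousAlternatingMap.sub_apply,
      edgeForm_sub_edgeForm c c' hU hγ hC hC' hcont hp,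
      c.boundaryForm_sub c' hU hγ hC hC' hcont hp]
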